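/- Let $R$ be a Dedekind domain with fraction field $F$ of characteristic different from $2$. For each maximal ideal $\mathfrak p$ of $R$ (place) let $\widehat R_{\mathfrak p}$ be the completion of $R$ at $\mathfrak p$ and $F_{\mathfrak p}$ its fraction field. Let $(V,f)$ be a nondegenerate quadratic space over $F$ with $3\le\dim V<\infty$, and let $L$ be an integral $R$-lattice on $V$, i.e. a finitely generated $R$-submodule of $V$ with $FL=V$ and $f(L)\subseteq R$. Put $V_{\mathfrak p}=F_{\mathfrak p}\otimes_F V$ and $K_{\mathfrak p}=\widehat R_{\mathfrak p}K\subseteq V_{\mathfrak p}$ for a lattice $K$ on $V$. Write $O^+$ for special orthogonal groups and $O^+(L_{\mathfrak p})=\{\sigma\in O^+(V_{\mathfrak p}) : \sigma(L_{\mathfrak p})=L_{\mathfrak p}\}$. Let $\theta:O^+(V)\to F^\times/F^{\times2}$ and $\theta_{\mathfrak p}:O^+(V_{\mathfrak p})\to F_{\mathfrak p}^\times/F_{\mathfrak p}^{\times2}$ be the spinor norm maps, sending a product of symmetries along anisotropic vectors $u_1,\dots,u_m$ to the class of $f(u_1)\cdots f(u_m)$; the image $\theta_{\mathfrak p}(X)$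 of a subset $X$ is also viewed as the corresponding union of cosets in $F_{\mathfrak p}^\times$. The genus of $L$ is the set of lattices $K$ on $V$ for which there are $\sigma_{\mathfrak p}\in O^+(V_{\mathfrak p})$ for all $\mathfrak p$, with $\sigma_{\mathfrak p}L_{\mathfrak p}=L_{\mathfrak p}$ for almost all $\mathfrak p$, such that $K_{\mathfrak p}=\sigma_{\mathfrak p}L_{\mathfrak p}$ for all $\mathfrak p$. The proper class of a lattice is its $O^+(V)$-orbit, and the proper class number $h^+(L)\in\mathbb N\cup\{\infty\}$ is the number of proper classes in the genus of $L$. Let $G=\mathbf{Spin}(V)$. Suppose that $G$ satisfies strong approximation over $R$: the diagonal image of $G(F)$ is dense in the restricted topological product of the groups $G(F_{\mathfrak p})$ with respect to the subsets $G(\widehat R_{\mathfrak p})$ (defined for almost all $\mathfrak p$ by an integral model of $G$), over all maximal ideals $\mathfrak p$ of $R$. Explicitly, for every large enough finite set $\Sigma$ of maximal ideals and every choice of nonempty open sets $U_{\mathfrak p}\subseteq G(F_{\mathfrak p})$ for $\mathfrak p\in\Sigma$, there is an element of $G(F)$ lying in $U_{\mathfrak p}$ for all $\mathfrak p\in\Sigma$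 and in $G(\widehat R_{\mathfrak p})$ for all $\mathfrak p\notin\Sigma$. Suppose moreover that (i) the spinor norm map $\theta:O^+(V)\to F^\times/F^{\times2}$ is surjective; (ii) $\theta_{\mathfrak p}(O^+(L_{\mathfrak p}))\supseteq\widehat R_{\mathfrak p}^\times$ for every maximal ideal $\mathfrak p$ of $R$. If $\mathrm{Pic}(R)/2:=\mathrm{Pic}(R)\otimes_{\mathbb Z}\mathbb Z/2\mathbb Z$ is finite, then $h^+(L)$ is finite and divides $\#(\mathrm{Pic}(R)/2)$. In particular, $h^+(L)=1$ if $R$ is a principal ideal domain. -/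

import Mathlib

open scoped TensorProduct
open IsDedekindDomain

namespace SpinLattice

section OverAField

variable {E W : Type*} [Field E] [AddCommGroup W] [Module E W]

/-- The special orthogonal group of a quadratic space `(W, q)` over a field of characteristic
different from `2`: the linear automorphisms preserving `q` with determinant `1`. -/
def specialOrthogonal (q : QuadraticForm E W) : Subgroup (W ≃ₗ[E] W) where
  carrier := {σ | (∀ x, q (σ x) = q x) ∧ LinearMap.det (σ : W →ₗ[E] W) = 1}
  one_mem' := ⟨fun _ => rfl, LinearMap.det_id⟩
  mul_mem' := by
    rintro σ τ ⟨hσ, hσ'⟩ ⟨hτ, hτ'⟩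
    refine ⟨fun x => (hσ (τ x)).trans (hτ x), ?_⟩
    have h : ((σ * τ : W ≃ₗ[E] W) : W →ₗ[E] W) = (σ : W →ₗ[E] W) ∘ₗ (τ : W →ₗ[E] W) := rfl
    rw [h, LinearMap.det_comp, hσ', hτ', one_mul]
  inv_mem' := by
    rintro σ ⟨hσ, hσ'⟩
    refine ⟨fun x => ?_, ?_⟩
    · have h := hσ (σ.symm x)
      rw [σ.apply_symm_apply] at h
      exact h.symm
    · have h := LinearEquiv.det_symm_mul_det σ
      rw [hσ', mul_one] at h
      exact h

/-- The symmetry `x ↦ x - (b(x, u) / q(u)) u` along `u`, where `b` is the polar form of `q`;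
meaningful when `q u ≠ 0`. -/
def symmetryAlong (q : QuadraticForm E W) (u : W) : Module.End E W :=
  LinearMap.id - ((q u)⁻¹ • q.polarBilin u).smulRight u

/-- `IsSpinorNorm q σ a`: the class of `a` in `Eˣ/Eˣ²` is the spinor norm `θ(σ)`. That is, `σ` is
a product of symmetries along anisotropic vectors `u₁, …, uₘ`, and `a` equals `q(u₁)⋯q(uₘ)`
up to the square of a unit. -/
def IsSpinorNorm (q : QuadraticForm E W) (σ : W ≃ₗ[E] W) (a : Eˣ) : Prop :=
  ∃ l : List W, (∀ u ∈ l, q u ≠ 0) ∧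
    (σ : W →ₗ[E] W) = (l.map (symmetryAlong q)).prod ∧
    ∃ c : Eˣ, (a : E) = (c : E) ^ 2 * (l.map q).prod

/-- For a set `X` of isometries, `θ(X)` viewed as a union of cosets of `Eˣ²` in `Eˣ`. -/
def spinorNorms (q : QuadraticForm E W) (X : Set (W ≃ₗ[E] W)) : Set Eˣ :=
  {a | ∃ σ ∈ X, IsSpinorNorm q σ a}

/-- Open sets of `Spin(W, q)` for a topological field `E`: the spin group has the subspace
topology of the Clifford algebra, a finite-dimensional `E`-vector space with its canonical
topology. -/
def IsOpenSpin [TopologicalSpace E] (q : QuadraticForm E W) (U : Set (spinGroup q)) : Prop :=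
  @IsOpen _ ((moduleTopology E (CliffordAlgebra q)).induced Subtype.val) U

end OverAField

section OverADedekindDomain

variable {R : Type*} [CommRing R] [IsDedekindDomain R]
  {F : Type*} [Field F] [Algebra R F] [IsFractionRing R F]
  {V : Type*} [AddCommGroup V] [Module F V] [Module R V] [IsScalarTower R F V]

/-- The localization `V_𝔭 = F_𝔭 ⊗ V` of an `F`-vector space at a place `𝔭`. -/
abbrev LocalSpace (F : Type*) [Field F] [Algebra R F] [IsFractionRing R F]
    (V : Type*) [AddCommGroup V] [Module F V] (𝔭 : HeightOneSpectrum R) : Type _ :=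
  𝔭.adicCompletion F ⊗[F] V

/-- The localized quadratic form `f_𝔭` on `V_𝔭`. -/
noncomputable abbrev localForm [Invertible (2 : F)] (f : QuadraticForm F V)
    (𝔭 : HeightOneSpectrum R) :
    QuadraticForm (𝔭.adicCompletion F) (LocalSpace F V 𝔭) :=
  f.baseChange (𝔭.adicCompletion F)

/-- `L_𝔭`: the submodule of `V_𝔭` generated by `L` over the completion of `R` at `𝔭`. -/
noncomputable def localLattice (L : Submodule R V) (𝔭 : HeightOneSpectrum R) :
    Submodule (𝔭.adicCompletionIntegers F) (LocalSpace F V 𝔭) :=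
  Submodule.span (𝔭.adicCompletionIntegers F)
    ((fun x : V => (1 : 𝔭.adicCompletion F) ⊗ₜ[F] x) '' (L : Set V))

/-- The image of the local lattice `M` under an automorphism `σ` of `V_𝔭`. -/
noncomputable def mapLocal {𝔭 : HeightOneSpectrum R}
    (σ : LocalSpace F V 𝔭 ≃ₗ[𝔭.adicCompletion F] LocalSpace F V 𝔭)
    (M : Submodule (𝔭.adicCompletionIntegers F) (LocalSpace F V 𝔭)) :
    Submodule (𝔭.adicCompletionIntegers F) (LocalSpace F V 𝔭) :=
  M.map (σ.toLinearMap.restrictScalars (𝔭.adicCompletionIntegers F))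

/-- The image of `L` under an automorphism `σ` of `V`. -/
def mapGlobal (σ : V ≃ₗ[F] V) (L : Submodule R V) : Submodule R V :=
  L.map (σ.toLinearMap.restrictScalars R)

/-- `O⁺(L_𝔭)`: the elements of `O⁺(V_𝔭)` mapping `L_𝔭` onto itself. -/
def localStabilizer [Invertible (2 : F)] (f : QuadraticForm F V) (L : Submodule R V)
    (𝔭 : HeightOneSpectrum R) :
    Set (LocalSpace F V 𝔭 ≃ₗ[𝔭.adicCompletion F] LocalSpace F V 𝔭) :=
  {σ | σ ∈ specialOrthogonal (localForm f 𝔭) ∧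
    mapLocal σ (localLattice L 𝔭) = localLattice L 𝔭}

/-- `O⁺_𝐀(V)`: families `(σ_𝔭)` with `σ_𝔭 ∈ O⁺(V_𝔭)` for all `𝔭` and `σ_𝔭 L_𝔭 = L_𝔭` for almost
all `𝔭`. This does not depend on the lattice `L` on `V`. -/
def adelicSpecialOrthogonal [Invertible (2 : F)] (f : QuadraticForm F V) (L : Submodule R V) :
    Set (∀ 𝔭 : HeightOneSpectrum R,
      LocalSpace F V 𝔭 ≃ₗ[𝔭.adicCompletion F] LocalSpace F V 𝔭) :=
  {σ | (∀ 𝔭, σ 𝔭 ∈ specialOrthogonal (localForm f 𝔭)) ∧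
    {𝔭 | mapLocal (σ 𝔭) (localLattice L 𝔭) ≠ localLattice L 𝔭}.Finite}

/-- The proper class `cls⁺(L)`: the `O⁺(V)`-orbit of `L`. -/
def properClass (f : QuadraticForm F V) (L : Submodule R V) : Set (Submodule R V) :=
  {K | ∃ σ ∈ specialOrthogonal f, K = mapGlobal σ L}

/-- The genus `gen(L)`: the lattices `K` on `V` for which there is `(σ_𝔭) ∈ O⁺_𝐀(V)` with
`K_𝔭 = σ_𝔭 L_𝔭` for all `𝔭`. -/
def genus [Invertible (2 : F)] (f : QuadraticForm F V) (L : Submodule R V) :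
    Set (Submodule R V) :=
  {K | Submodule.IsLattice F K ∧ ∃ σ ∈ adelicSpecialOrthogonal f L,
    ∀ 𝔭, localLattice K 𝔭 = mapLocal (σ 𝔭) (localLattice L 𝔭)}

/-- The proper class number `h⁺(L)`: the number of proper classes in the genus of `L`. -/
noncomputable def properClassNumber [Invertible (2 : F)] (f : QuadraticForm F V)
    (L : Submodule R V) : ℕ∞ :=
  (properClass f '' genus f L).encard

/-- The map `C(V) → C(V_𝔭)` of Clifford algebras. -/
noncomputable def cliffordLocal [Invertible (2 : F)] (f : QuadraticForm F V)
    (𝔭 : HeightOneSpectrum R) (x : CliffordAlgebra f) : CliffordAlgebra (localForm f 𝔭) :=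
  CliffordAlgebra.ofBaseChange (𝔭.adicCompletion F) f (1 ⊗ₜ[F] x)

/-- `Λ_𝔭`: the submodule of `C(V_𝔭)` generated by `Λ ⊆ C(V)` over the completion of `R` at `𝔭`. -/
noncomputable def localCliffordLattice [Invertible (2 : F)] (f : QuadraticForm F V)
    (Λ : Submodule R (CliffordAlgebra f)) (𝔭 : HeightOneSpectrum R) :
    Submodule (𝔭.adicCompletionIntegers F) (CliffordAlgebra (localForm f 𝔭)) :=
  Submodule.span (𝔭.adicCompletionIntegers F)
    (cliffordLocal f 𝔭 '' (Λ : Set (CliffordAlgebra f)))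

/-- Strong approximation over `R` for the algebraic group `G = Spin(V)`. It is a closed
subvariety of the affine space of the vector space `C(V)`, so an `R`-lattice `Λ` in `C(V)` gives an
integral model of it (the closure of `G` in the affine space of `Λ`), with
`G(R_𝔭) = G(F_𝔭) ∩ Λ_𝔭`; two lattices give the same `G(R_𝔭)` for almost all `𝔭`, hence the same
adelic space. Density of `G(F)` in the adelic space means: for every large enough finite set `S` of
places and nonempty open `U_𝔭 ⊆ G(F_𝔭)` for `𝔭 ∈ S`, some `g ∈ G(F)` lies in `U_𝔭` for all `𝔭 ∈ S`
and in `G(R_𝔭)` for all `𝔭 ∉ S`. -/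
def SpinStrongApproximation (R : Type*) [CommRing R] [IsDedekindDomain R]
    {F : Type*} [Field F] [Algebra R F] [IsFractionRing R F] [Invertible (2 : F)]
    {V : Type*} [AddCommGroup V] [Module F V] [Module R V] [IsScalarTower R F V]
    (f : QuadraticForm F V) : Prop :=
  ∃ Λ : Submodule R (CliffordAlgebra f), Submodule.IsLattice F Λ ∧
    ∃ S₀ : Finset (HeightOneSpectrum R), ∀ S : Finset (HeightOneSpectrum R), S₀ ⊆ S →
      ∀ U : ∀ 𝔭 : HeightOneSpectrum R, Set (spinGroup (localForm f 𝔭)),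
        (∀ 𝔭 ∈ S, IsOpenSpin (localForm f 𝔭) (U 𝔭) ∧ (U 𝔭).Nonempty) →
        ∃ g ∈ spinGroup f,
          (∀ 𝔭 ∈ S, cliffordLocal f 𝔭 g ∈ Subtype.val '' U 𝔭) ∧
          ∀ 𝔭 ∉ S, cliffordLocal f 𝔭 g ∈ localCliffordLattice f Λ 𝔭

end OverADedekindDomain

/-- `Pic(R)/2 = Pic(R) ⊗_ℤ ℤ/2ℤ`. -/
abbrev PicModTwo (R : Type*) [CommRing R] : Type _ :=
  Additive (CommRing.Pic R) ⊗[ℤ] ZMod 2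

end SpinLattice

/-! Every lattice in the genus is `σL` for an adelic rotation `σ`. Once the components fixing `L_𝔭`
are replaced by the identity, the valuations of the local spinor norms are the exponents of a
fractional ideal `I` (`exists_isTransform_of_mem_genus`). Conversely, by (i) every fractional ideal
arises from some adelic rotation (`exists_hasSpinorIdeal`).

The proper class of `σL` depends only on `I`. If `σ` and `τ` have the same ideal, their local spinor
norms differ by units. By (ii) some `ω` stabilizing `L` locally corrects this, so that `τωσ⁻¹` has
spinor norm `1` at every place and lifts to the local spin groups. Strong approximation then yields
a global rotation acting on `σL` as `τωσ⁻¹` does, that is, sending it to `τL`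
(`IsTransform.properClass_eq`).

This defines a map `Φ` from fractional ideals onto the proper classes in the genus. Its fibres are
compatible with multiplication, since spinor norms are invariant under conjugation
(`IsTransform.exists_mul`). Principal ideals are sent to the class of `L`, because by (i) they come
from global rotations; so are squares, because the identity has every square as a spinor norm. Thus
the set of classes is in bijection with a quotient group of `Pic(R)/2`, and Lagrange's theorem gives
the divisibility. -/

namespace SpinLattice

/-! ### Symmetries, spinor norms and a Cartan–Dieudonné argument. -/

section Symmetries

variable {E W : Type*} [Field E] [AddCommGroup W] [Module E W] (q : QuadraticForm E W)

theorem symmetryAlong_apply (u x : W) :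
    symmetryAlong q u x = x - ((q u)⁻¹ * QuadraticMap.polar q u x) • u := by
  simp [symmetryAlong]

theorem quadraticForm_sub_smul (u x : W) (c : E) :
    q (x - c • u) = q x + c * c * q u - c * QuadraticMap.polar q u x := by
  have h := QuadraticMap.map_add q x (-(c • u))
  rw [← sub_eq_add_neg, QuadraticMap.map_neg, QuadraticMap.map_smul, QuadraticMap.polar_neg_right,
    QuadraticMap.polar_smul_right, QuadraticMap.polar_comm] at h
  rw [h]
  simp only [smul_eq_mul]
  ring

theorem quadraticForm_symmetryAlong {u : W} (hu : q u ≠ 0) (x : W) :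
    q (symmetryAlong q u x) = q x := by
  rw [symmetryAlong_apply, quadraticForm_sub_smul]
  field_simp
  ring

theorem symmetryAlong_of_polar_eq_zero {u x : W} (h : QuadraticMap.polar q u x = 0) :
    symmetryAlong q u x = x := by
  simp [symmetryAlong_apply, h]

theorem symmetryAlong_self {u : W} (hu : q u ≠ 0) : symmetryAlong q u u = -u := by
  have h : (q u)⁻¹ * (2 * q u) = 2 := by field_simp
  rw [symmetryAlong_apply, QuadraticMap.polar_self, nsmul_eq_mul, Nat.cast_ofNat, h, two_smul]
  abel

theorem symmetryAlong_symmetryAlong {u : W} (hu : q u ≠ 0) (x : W) :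
    symmetryAlong q u (symmetryAlong q u x) = x := by
  conv_lhs => rw [symmetryAlong_apply q u x]
  rw [map_sub, map_smul, symmetryAlong_self q hu, symmetryAlong_apply]
  simp

theorem symmetryAlong_mul_self {u : W} (hu : q u ≠ 0) :
    symmetryAlong q u * symmetryAlong q u = 1 :=
  LinearMap.ext (symmetryAlong_symmetryAlong q hu)

/-- Rescaling one vector multiplies the product of the values of `q` by a square and leaves the
isometry alone; this removes the square factor in `IsSpinorNorm`. -/
theorem symmetryAlong_smul (u : W) {c : E} (hc : c ≠ 0) :
    symmetryAlong q (c • u) = symmetryAlong q u := by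
  ext x
  simp only [symmetryAlong_apply, QuadraticMap.map_smul, QuadraticMap.polar_smul_left, smul_smul,
    smul_eq_mul]
  congr 2
  by_cases hu : q u = 0
  · simp [hu]
  · field_simp

/-- A symmetry is a transvection `x ↦ x + φ(x)u`, of determinant `1 + φ(u)`; here `φ(u) = -2`. -/
theorem det_symmetryAlong [FiniteDimensional E W] {u : W} (hu : q u ≠ 0) :
    LinearMap.det (symmetryAlong q u) = -1 := by
  have h : symmetryAlong q u =
      LinearMap.transvection (-((q u)⁻¹ • q.polarBilin u)) u := by
    ext x
    rw [symmetryAlong_apply, LinearMap.transvection.apply]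
    simp [sub_eq_add_neg]
  rw [h, LinearMap.transvection.det]
  simp only [LinearMap.neg_apply, LinearMap.smul_apply, QuadraticMap.polarBilin_apply_apply,
    QuadraticMap.polar_self, nsmul_eq_mul, Nat.cast_ofNat, smul_eq_mul]
  field_simp
  ring

theorem quadraticForm_prod_symmetryAlong {l : List W} (hl : ∀ u ∈ l, q u ≠ 0) (x : W) :
    q ((l.map (symmetryAlong q)).prod x) = q x := by
  induction l with
  | nil => simp
  | cons u l ih =>
    rw [List.map_cons, List.prod_cons, Module.End.mul_apply,
      quadraticForm_symmetryAlong q (hl u (by simp)), ih fun v hv => hl v (by simp [hv])]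

theorem det_prod_symmetryAlong [FiniteDimensional E W] {l : List W} (hl : ∀ u ∈ l, q u ≠ 0) :
    LinearMap.det (l.map (symmetryAlong q)).prod = (-1) ^ l.length := by
  induction l with
  | nil => simp
  | cons u l ih =>
    rw [List.map_cons, List.prod_cons, map_mul, det_symmetryAlong q (hl u (by simp)),
      ih fun v hv => hl v (by simp [hv]), List.length_cons, pow_succ']

theorem reverse_prod_symmetryAlong_mul {l : List W} (hl : ∀ u ∈ l, q u ≠ 0) :
    (l.reverse.map (symmetryAlong q)).prod * (l.map (symmetryAlong q)).prod = 1 := by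
  induction l with
  | nil => simp
  | cons u l ih =>
    simp only [List.reverse_cons, List.map_append, List.prod_append, List.map_cons, List.map_nil,
      List.prod_cons, List.prod_nil, mul_one]
    rw [mul_assoc, ← mul_assoc (symmetryAlong q u), symmetryAlong_mul_self q (hl u (by simp)), one_mul, ih fun v hv => hl v (by simp [hv])]

theorem prod_symmetryAlong_mul_reverse {l : List W} (hl : ∀ u ∈ l, q u ≠ 0) :
    (l.map (symmetryAlong q)).prod * (l.reverse.map (symmetryAlong q)).prod = 1 := by
  simpa using reverse_prod_symmetryAlong_mul q (l := l.reverse) (by simpa using hl)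

/-- A product of symmetries, as a linear automorphism. -/
theorem exists_equiv_eq_prod_symmetryAlong {l : List W} (hl : ∀ u ∈ l, q u ≠ 0) :
    ∃ σ : W ≃ₗ[E] W, (σ : W →ₗ[E] W) = (l.map (symmetryAlong q)).prod :=
  ⟨LinearEquiv.ofLinearMap _ _ (prod_symmetryAlong_mul_reverse q hl)
    (reverse_prod_symmetryAlong_mul q hl), rfl⟩

variable {q}

theorem polar_map_of_isometry {φ : W →ₗ[E] W} (hφ : ∀ x, q (φ x) = q x) (x y : W) :
    QuadraticMap.polar q (φ x) (φ y) = QuadraticMap.polar q x y := by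
  simp only [QuadraticMap.polar, ← map_add, hφ]

namespace IsSpinorNorm

theorem one : IsSpinorNorm q (1 : W ≃ₗ[E] W) 1 :=
  ⟨[], by simp, rfl, 1, by simp⟩

theorem mul_sq {σ : W ≃ₗ[E] W} {a : Eˣ} (h : IsSpinorNorm q σ a) (d : Eˣ) :
    IsSpinorNorm q σ (a * d ^ 2) := by
  obtain ⟨l, hl, hσ, c, hc⟩ := h
  refine ⟨l, hl, hσ, c * d, ?_⟩
  push_cast
  rw [hc]
  ring

theorem mul {σ τ : W ≃ₗ[E] W} {a b : Eˣ} (hσ : IsSpinorNorm q σ a) (hτ : IsSpinorNorm q τ b) :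
    IsSpinorNorm q (σ * τ) (a * b) := by
  obtain ⟨l, hl, hσ, c, hc⟩ := hσ
  obtain ⟨m, hm, hτ, d, hd⟩ := hτ
  refine ⟨l ++ m, ?_, ?_, c * d, ?_⟩
  · intro u hu
    rcases List.mem_append.1 hu with hu | hu
    exacts [hl u hu, hm u hu]
  · rw [List.map_append, List.prod_append, ← hσ, ← hτ]
    rfl
  · push_cast
    rw [List.map_append, List.prod_append, hc, hd]
    ring

theorem inv {σ : W ≃ₗ[E] W} {a : Eˣ} (h : IsSpinorNorm q σ a) : IsSpinorNorm q σ⁻¹ a⁻¹ := by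
  obtain ⟨l, hl, hσ, c, hc⟩ := h
  -- The reversed word represents the inverse with the same product of values; `a` and `a⁻¹` differ
  -- by a square.
  have key : IsSpinorNorm q σ⁻¹ a := by
    refine ⟨l.reverse, by simpa using hl, ?_, c, by rw [hc, List.map_reverse, List.prod_reverse]⟩
    have h1 : (σ : Module.End E W) * (↑σ⁻¹ : W →ₗ[E] W) = 1 :=
      LinearMap.ext fun x => σ.apply_symm_apply x
    rw [hσ] at h1
    calc (↑σ⁻¹ : W →ₗ[E] W) = (1 : Module.End E W) * (↑σ⁻¹ : W →ₗ[E] W) := (one_mul _).symm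
      _ = _ := by rw [← reverse_prod_symmetryAlong_mul q hl, mul_assoc, h1, mul_one]
  have h2 := key.mul_sq a⁻¹
  have h3 : a * a⁻¹ ^ 2 = a⁻¹ := by rw [sq, mul_inv_cancel_left]
  rwa [h3] at h2

end IsSpinorNorm

/-- A weak form of the theorem of Cartan and Dieudonné: the isometries of a quadratic space with an
orthogonal basis of anisotropic vectors are products of symmetries. -/
theorem exists_isSpinorNorm {ι : Type*} [Finite ι] [Invertible (2 : E)] (b : Module.Basis ι E W)
    (hb : ∀ i j, i ≠ j → QuadraticMap.polar q (b i) (b j) = 0) (hb' : ∀ i, q (b i) ≠ 0)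
    {σ : W ≃ₗ[E] W} (hσ : ∀ x, q (σ x) = q x) : ∃ a, IsSpinorNorm q σ a := by
  classical
  have := Fintype.ofFinite ι
  -- Induction on the set of basis vectors already brought back to their place: `φ` is `σ` followed
  -- by the symmetries found so far.
  have key : ∀ s : Finset ι, ∃ l : List W, (∀ u ∈ l, q u ≠ 0) ∧
      ∀ i ∈ s, (l.map (symmetryAlong q)).prod (σ (b i)) = b i := by
    intro s
    induction s using Finset.induction_on with
    | empty => exact ⟨[], by simp, by simp⟩
    | insert j s hj ih =>
      obtain ⟨l, hl, hfix⟩ := ih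
      set φ : W →ₗ[E] W := (l.map (symmetryAlong q)).prod ∘ₗ (σ : W →ₗ[E] W) with hφdef
      have hφ : ∀ x, q (φ x) = q x := fun x => by
        simp [hφdef, quadraticForm_prod_symmetryAlong q hl, hσ]
      have hfix' : ∀ i ∈ s, φ (b i) = b i := hfix
      have horth : ∀ i ∈ s, QuadraticMap.polar q (φ (b j)) (b i) = 0 := fun i hi => by
        have hne : j ≠ i := fun h => hj (h ▸ hi)
        conv_lhs => rw [← hfix' i hi]
        rw [polar_map_of_isometry hφ, hb j i hne]
      have horth' : ∀ i ∈ s, QuadraticMap.polar q (b j) (b i) = 0 := fun i hi =>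
        hb j i fun h => hj (h ▸ hi)
      have e1 := quadraticForm_sub_smul q (b j) (φ (b j)) 1
      have e2 := quadraticForm_sub_smul q (b j) (φ (b j)) (-1)
      have hp : QuadraticMap.polar q (φ (b j)) (φ (b j)) = 2 * q (b j) := by
        rw [QuadraticMap.polar_self, hφ, nsmul_eq_mul, Nat.cast_ofNat]
      have hcomm := QuadraticMap.polar_comm q (φ (b j)) (b j)
      have h2 : (2 : E) ≠ 0 := Invertible.ne_zero 2
      simp only [one_smul, neg_smul, sub_neg_eq_add, hφ] at e1 e2
      by_cases h : q (φ (b j) - b j) = 0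
      -- Parallelogram law: `q(φb - b) + q(φb + b) = 4 q(b) ≠ 0`, so at least one of the two vectors
      -- is anisotropic.
      · have h' : q (φ (b j) + b j) ≠ 0 := by
          intro h'
          have h4 : (2 * 2) * q (b j) = 0 := by linear_combination h + h' - e1 - e2
          exact mul_ne_zero (mul_ne_zero h2 h2) (hb' j) h4
        -- The symmetry along `φb + b` sends `φb` to `-b`, and the one along `b` restores the sign.
        -- Both vectors are orthogonal to the basis vectors already fixed.
        refine ⟨b j :: (φ (b j) + b j) :: l, ?_, ?_⟩
        · intro u hu
          rcases List.mem_cons.1 hu with rfl | hu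
          · exact hb' j
          rcases List.mem_cons.1 hu with rfl | hu
          exacts [h', hl u hu]
        · intro i hi
          simp only [List.map_cons, List.prod_cons, Module.End.mul_apply]
          change symmetryAlong q (b j) (symmetryAlong q (φ (b j) + b j) (φ (b i))) = b i
          rcases Finset.mem_insert.1 hi with rfl | hi
          · have hpol : QuadraticMap.polar q (φ (b i) + b i) (φ (b i)) = q (φ (b i) + b i) := by
              rw [QuadraticMap.polar_add_left, hp]
              linear_combination -e2
            rw [symmetryAlong_apply q (φ (b i) + b i), hpol, inv_mul_cancel₀ h', one_smul,
              sub_add_cancel_left, map_neg, symmetryAlong_self q (hb' i), neg_neg]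
          · rw [hfix' i hi, symmetryAlong_of_polar_eq_zero q (u := φ (b j) + b j),
              symmetryAlong_of_polar_eq_zero q (horth' i hi)]
            rw [QuadraticMap.polar_add_left, horth i hi, horth' i hi, add_zero]
      -- Here one symmetry suffices: the one along `φb - b` sends `φb` to `b`.
      · refine ⟨(φ (b j) - b j) :: l, ?_, ?_⟩
        · intro u hu
          rcases List.mem_cons.1 hu with rfl | hu
          exacts [h, hl u hu]
        · intro i hi
          simp only [List.map_cons, List.prod_cons, Module.End.mul_apply]
          change symmetryAlong q (φ (b j) - b j) (φ (b i)) = b i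
          rcases Finset.mem_insert.1 hi with rfl | hi
          · have hpol : QuadraticMap.polar q (φ (b i) - b i) (φ (b i)) = q (φ (b i) - b i) := by
              rw [QuadraticMap.polar_sub_left, hp]
              linear_combination -e1
            rw [symmetryAlong_apply, hpol, inv_mul_cancel₀ h, one_smul, sub_sub_cancel]
          · rw [hfix' i hi, symmetryAlong_of_polar_eq_zero q]
            rw [QuadraticMap.polar_sub_left, horth i hi, horth' i hi, sub_zero]
  obtain ⟨l, hl, hfix⟩ := key Finset.univ
  have hone : (l.map (symmetryAlong q)).prod * (σ : Module.End E W) = 1 :=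
    b.ext fun i => hfix i (Finset.mem_univ i)
  have hprod : (l.reverse.map q).prod ≠ 0 := by
    rw [ne_eq, List.prod_eq_zero_iff]
    simpa using hl
  refine ⟨Units.mk0 _ hprod, l.reverse, by simpa using hl, ?_, 1, by simp⟩
  calc (σ : Module.End E W) = 1 * (σ : Module.End E W) := (one_mul _).symm
    _ = _ := by rw [← reverse_prod_symmetryAlong_mul q hl, mul_assoc, hone, mul_one]

end Symmetries

/-! ### The spin group as products of vectors, and its map to rotations. -/

section Spin

variable {E W : Type*} [Field E] [AddCommGroup W] [Module E W] (q : QuadraticForm E W)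

open CliffordAlgebra

/-- This is the Clifford relation `uv + vu = b(u, v)` rewritten: conjugation by `u` is minus the
symmetry along `u`. -/
theorem ι_mul_ι_eq_neg_symmetryAlong {u : W} (hu : q u ≠ 0) (v : W) :
    ι q u * ι q v = -(ι q (symmetryAlong q u v) * ι q u) := by
  have h : (q u)⁻¹ * QuadraticMap.polar q u v * q u = QuadraticMap.polar q u v := by
    field_simp
  rw [symmetryAlong_apply, map_sub, map_smul, sub_mul, smul_mul_assoc, ι_sq_scalar,
    Algebra.smul_def, ← map_mul (algebraMap E (CliffordAlgebra q)), h, ← ι_mul_ι_add_swap]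
  abel

theorem prod_ι_mul_ι {l : List W} (hl : ∀ u ∈ l, q u ≠ 0) (v : W) :
    (l.map (ι q)).prod * ι q v =
      (-1) ^ l.length * (ι q ((l.map (symmetryAlong q)).prod v) * (l.map (ι q)).prod) := by
  induction l with
  | nil => simp
  | cons u l ih =>
    have hc : ι q u * (-1) ^ l.length = (-1) ^ l.length * ι q u :=
      ((Commute.neg_one_right _).pow_right _).eq
    rw [List.map_cons, List.prod_cons, mul_assoc, ih fun v hv => hl v (by simp [hv]),
      ← mul_assoc, hc, mul_assoc, ← mul_assoc (ι q u),
      ι_mul_ι_eq_neg_symmetryAlong q (hl u (by simp)), List.length_cons, pow_succ, List.map_cons,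
      List.prod_cons, Module.End.mul_apply]
    simp only [mul_assoc, neg_mul, mul_neg, one_mul]

/-- Each vector satisfies `star u * u = -q(u)`, a scalar, so the word collapses from the inside. An
even word with product of values `1` is therefore unitary. -/
theorem star_prod_ι_mul_prod_ι (l : List W) :
    star (l.map (ι q)).prod * (l.map (ι q)).prod =
      algebraMap E _ ((-1) ^ l.length * (l.map q).prod) := by
  induction l with
  | nil => simp
  | cons u l ih =>
    rw [List.map_cons, List.prod_cons, star_mul, star_ι, mul_assoc, ← mul_assoc (-ι q u), neg_mul,
      ι_sq_scalar, ← map_neg, Algebra.left_comm, ih, ← map_mul]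
    congr 1
    simp only [List.map_cons, List.prod_cons, List.length_cons, pow_succ]
    ring

theorem prod_ι_mem_evenOdd (l : List W) : (l.map (ι q)).prod ∈ evenOdd q l.length := by
  induction l with
  | nil => simpa using one_le_evenOdd_zero q (Submodule.one_le.1 le_rfl)
  | cons u l ih =>
    rw [List.map_cons, List.prod_cons, List.length_cons, Nat.cast_succ, add_comm]
    exact evenOdd_mul_le q _ _ (Submodule.mul_mem_mul (ι_mem_evenOdd_one q u) ih)

theorem exists_unit_lipschitz_eq_prod_ι {l : List W} (hl : ∀ u ∈ l, q u ≠ 0) :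
    ∃ x ∈ lipschitzGroup q, (x : CliffordAlgebra q) = (l.map (ι q)).prod := by
  induction l with
  | nil => exact ⟨1, one_mem _, by simp⟩
  | cons u l ih =>
    obtain ⟨x, hx, hxl⟩ := ih fun v hv => hl v (by simp [hv])
    obtain ⟨y, hy⟩ := isUnit_ι_of_isUnit q (hl u (by simp)).isUnit
    exact ⟨y * x, mul_mem (Subgroup.subset_closure ⟨u, hy.symm⟩) hx, by simp [hy, hxl]⟩

/-- The inverse of an anisotropic vector `u` is the vector `u / q(u)`, so no inverses are needed in
a word. -/
theorem exists_prod_ι_of_mem_lipschitzGroup [Invertible (2 : E)] {x : (CliffordAlgebra q)ˣ}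
    (hx : x ∈ lipschitzGroup q) :
    ∃ l : List W, (∀ u ∈ l, q u ≠ 0) ∧ (x : CliffordAlgebra q) = (l.map (ι q)).prod := by
  induction hx using Subgroup.closure_induction'' with
  | mem x hx =>
    obtain ⟨u, hu⟩ := hx
    exact ⟨[u], by simpa using (isUnit_of_isUnit_ι q (hu ▸ x.isUnit)).ne_zero, by simp [hu]⟩
  | inv_mem x hx =>
    obtain ⟨u, hu⟩ := hx
    have hqu : q u ≠ 0 := (isUnit_of_isUnit_ι q (hu ▸ x.isUnit)).ne_zero
    refine ⟨[(q u)⁻¹ • u], by simp [QuadraticMap.map_smul, hqu], ?_⟩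
    refine Units.inv_eq_of_mul_eq_one_left ?_
    rw [List.map_singleton, List.prod_singleton, ← hu, map_smul, smul_mul_assoc, ι_sq_scalar,
      Algebra.smul_def, ← map_mul (algebraMap E (CliffordAlgebra q)), inv_mul_cancel₀ hqu, map_one]
  | one => exact ⟨[], by simp, by simp⟩
  | mul x y _ _ hx hy =>
    obtain ⟨l, hl, hxl⟩ := hx
    obtain ⟨m, hm, hym⟩ := hy
    refine ⟨l ++ m, fun u hu => (List.mem_append.1 hu).elim (hl u) (hm u), by simp [hxl, hym]⟩

/-- Isometries of determinant and spinor norm `1` lift to the spin group. -/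
theorem exists_spinGroup_of_isSpinorNorm_one [FiniteDimensional E W] [Invertible (2 : E)]
    {σ : W ≃ₗ[E] W} (hσ : σ ∈ specialOrthogonal q) (h : IsSpinorNorm q σ 1) :
    ∃ g ∈ spinGroup q, ∀ v, g * ι q v * star g = ι q (σ v) := by
  -- The square factor `c²` is absorbed by scaling the first vector by `c`; for the empty word the
  -- product is already `1`.
  have hnorm : ∃ l : List W, (∀ u ∈ l, q u ≠ 0) ∧
      (σ : W →ₗ[E] W) = (l.map (symmetryAlong q)).prod ∧ (l.map q).prod = 1 := by
    obtain ⟨l, hl, hσl, c, hc⟩ := h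
    match l, hl, hσl, hc with
    | [], hl, hσl, hc => exact ⟨[], hl, hσl, rfl⟩
    | u :: l, hl, hσl, hc =>
      refine ⟨(c : E) • u :: l, ?_, ?_, ?_⟩
      · intro v hv
        rcases List.mem_cons.1 hv with rfl | hv
        · simpa [QuadraticMap.map_smul] using hl u (by simp)
        · exact hl v (by simp [hv])
      · rw [hσl, List.map_cons, List.map_cons, symmetryAlong_smul q u c.ne_zero]
      · rw [List.map_cons, List.prod_cons, QuadraticMap.map_smul, smul_eq_mul, ← sq, mul_assoc,
          ← List.prod_cons, ← List.map_cons, ← hc, Units.val_one]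
  obtain ⟨l, hl, hσl, hq⟩ := hnorm
  have hlen : (-1 : E) ^ l.length = 1 := by
    rw [← det_prod_symmetryAlong q hl, ← hσl]
    exact hσ.2
  have heven : Even l.length := by
    by_contra hodd
    rw [Nat.not_even_iff_odd] at hodd
    rw [hodd.neg_one_pow] at hlen
    have h2 : (2 : E) ≠ 0 := Invertible.ne_zero 2
    exact h2 (by linear_combination -hlen)
  obtain ⟨x, hx, hxl⟩ := exists_unit_lipschitz_eq_prod_ι q hl
  have hstar : star (l.map (ι q)).prod * (l.map (ι q)).prod = 1 := by
    rw [star_prod_ι_mul_prod_ι, hlen, hq, mul_one, map_one]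
  have hstar' : (l.map (ι q)).prod * star (l.map (ι q)).prod = 1 := by
    rw [← hxl] at hstar ⊢
    rw [← Units.inv_eq_of_mul_eq_one_left hstar, Units.mul_inv]
  refine ⟨(l.map (ι q)).prod, ⟨⟨⟨x, hx, hxl⟩, hstar, hstar'⟩, ?_⟩, fun v => ?_⟩
  · have := prod_ι_mem_evenOdd q l
    rwa [(ZMod.natCast_eq_zero_iff_even).2 heven] at this
  · rw [prod_ι_mul_ι q hl, heven.neg_one_pow, one_mul, mul_assoc, hstar', mul_one, ← hσl]
    rfl

/-- An element of the spin group is an even word in anisotropic vectors, and conjugation by it is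
the product of the corresponding symmetries. A word of odd length would satisfy `g = -g`, hence
vanish. -/
theorem exists_specialOrthogonal_of_mem_spinGroup [FiniteDimensional E W] [Invertible (2 : E)]
    {g : CliffordAlgebra q} (hg : g ∈ spinGroup q) :
    ∃ σ ∈ specialOrthogonal q, ∀ v, g * ι q v * star g = ι q (σ v) := by
  obtain ⟨x, hx, hxg⟩ := hg.1.1
  obtain ⟨l, hl, hxl⟩ := exists_prod_ι_of_mem_lipschitzGroup q hx
  have hgl : g = (l.map (ι q)).prod := hxg.symm.trans hxl
  have heven : Even l.length := by
    by_contra hodd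
    rw [Nat.not_even_iff_odd] at hodd
    have h1 : involute g = -g := by
      have := prod_ι_mem_evenOdd q l
      rw [(ZMod.natCast_eq_one_iff_odd).2 hodd, ← hgl] at this
      exact involute_eq_of_mem_odd this
    rw [spinGroup.involute_eq hg] at h1
    have h2 : (2 : E) • g = 0 := by rw [two_smul]; nth_rw 2 [h1]; simp
    have h3 : g = 0 := (smul_eq_zero.1 h2).resolve_left (Invertible.ne_zero 2)
    exact x.ne_zero (by rw [← h3]; exact hxg)
  obtain ⟨σ, hσ⟩ := exists_equiv_eq_prod_symmetryAlong q hl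
  refine ⟨σ, ⟨fun v => ?_, ?_⟩, fun v => ?_⟩
  · rw [← LinearEquiv.coe_coe, hσ, quadraticForm_prod_symmetryAlong q hl]
  · rw [hσ, det_prod_symmetryAlong q hl, heven.neg_one_pow]
  · have hstar := spinGroup.mul_star_self_of_mem hg
    rw [hgl] at hstar ⊢
    rw [prod_ι_mul_ι q hl, heven.neg_one_pow, one_mul, mul_assoc, hstar, mul_one, ← hσ]
    rfl

end Spin

/-! ### Clearing denominators in lattices. -/

section Denominators

variable {R : Type*} [CommRing R] [IsDomain R]
  {F : Type*} [Field F] [Algebra R F] [IsFractionRing R F]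
  {V : Type*} [AddCommGroup V] [Module F V] [Module R V] [IsScalarTower R F V]

theorem exists_smul_mem_of_span_eq_top {B : Submodule R V}
    (hB : Submodule.span F (B : Set V) = ⊤) (x : V) : ∃ d : R, d ≠ 0 ∧ d • x ∈ B := by
  have hx : x ∈ Submodule.span F (B : Set V) := hB ▸ Submodule.mem_top
  induction hx using Submodule.span_induction with
  | mem x hx => exact ⟨1, one_ne_zero, by simpa using hx⟩
  | zero => exact ⟨1, one_ne_zero, by simp⟩
  | add x y _ _ hx hy =>
    obtain ⟨d, hd, hdx⟩ := hx
    obtain ⟨e, he, hey⟩ := hy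
    refine ⟨d * e, mul_ne_zero hd he, ?_⟩
    rw [smul_add]
    refine B.add_mem ?_ ?_
    · rw [mul_comm, mul_smul]; exact B.smul_mem _ hdx
    · rw [mul_smul]; exact B.smul_mem _ hey
  | smul c x _ hx =>
    obtain ⟨d, hd, hdx⟩ := hx
    obtain ⟨a, b, hb, rfl⟩ := IsFractionRing.div_surjective (A := R) c
    refine ⟨b * d, mul_ne_zero (nonZeroDivisors.ne_zero hb) hd, ?_⟩
    have hb' : algebraMap R F b ≠ 0 := by simpa using nonZeroDivisors.ne_zero hb
    have : (b * d) • (algebraMap R F a / algebraMap R F b) • x = a • d • x := by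
      rw [← algebraMap_smul F (b * d), ← algebraMap_smul F a, ← algebraMap_smul F d, smul_smul,
        smul_smul, map_mul]
      congr 1
      field_simp
    rw [this]
    exact B.smul_mem _ hdx

theorem exists_smul_mem_of_finite {ι : Type*} (s : Finset ι) {B : Submodule R V}
    (hB : Submodule.span F (B : Set V) = ⊤) (x : ι → V) :
    ∃ d : R, d ≠ 0 ∧ ∀ i ∈ s, d • x i ∈ B := by
  classical
  choose d hd hdx using fun i => exists_smul_mem_of_span_eq_top hB (x i)
  refine ⟨∏ i ∈ s, d i, Finset.prod_ne_zero_iff.2 fun i _ => hd i, fun i hi => ?_⟩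
  rw [← Finset.prod_erase_mul _ _ hi, mul_smul]
  exact B.smul_mem _ (hdx i)

theorem exists_smul_le {A B : Submodule R V} (hA : A.FG)
    (hB : Submodule.span F (B : Set V) = ⊤) : ∃ d : R, d ≠ 0 ∧ ∀ x ∈ A, d • x ∈ B := by
  obtain ⟨s, rfl⟩ := hA
  obtain ⟨d, hd, hds⟩ := exists_smul_mem_of_finite s hB id
  refine ⟨d, hd, fun x hx => ?_⟩
  induction hx using Submodule.span_induction with
  | mem x hx => exact hds x hx
  | zero => simp
  | add x y _ _ hx hy => rw [smul_add]; exact B.add_mem hx hy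
  | smul c x _ hx => rw [smul_comm]; exact B.smul_mem _ hx

end Denominators

/-! ### Valuations and approximation at the places of `R`. -/

section Places

variable {R : Type*} [CommRing R] [IsDedekindDomain R]
  {F : Type*} [Field F] [Algebra R F] [IsFractionRing R F]

theorem valued_algebraMap (𝔭 : HeightOneSpectrum R) (c : F) :
    Valued.v (algebraMap F (𝔭.adicCompletion F) c) = 𝔭.valuation F c :=
  HeightOneSpectrum.valuedAdicCompletion_eq_valuation' (v := 𝔭) c

theorem valued_algebraMap_of_base (𝔭 : HeightOneSpectrum R) (r : R) :
    Valued.v (algebraMap R (𝔭.adicCompletion F) r) = 𝔭.intValuation r := by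
  rw [IsScalarTower.algebraMap_apply R F, valued_algebraMap, HeightOneSpectrum.valuation_of_algebraMap]

theorem finite_setOf_mem {N : R} (hN : N ≠ 0) : {𝔭 : HeightOneSpectrum R | N ∈ 𝔭.asIdeal}.Finite := by
  have h : Ideal.span {N} ≠ 0 := by simpa using hN
  refine (Ideal.finite_factors h).subset fun 𝔭 hp => ?_
  simpa [Ideal.dvd_span_singleton] using hp

/-- Strong approximation for the affine line. -/
theorem exists_approx (𝔭 : HeightOneSpectrum R) {c : 𝔭.adicCompletion F} (hc : Valued.v c ≤ 1)
    {N : R} (hN : N ≠ 0) :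
    ∃ r : R, Valued.v (c - algebraMap R (𝔭.adicCompletion F) r) ≤ 𝔭.intValuation N ∧
      ∀ 𝔮 : HeightOneSpectrum R, 𝔮 ≠ 𝔭 → 𝔮.intValuation r ≤ 𝔮.intValuation N := by
  classical
  have hN0 : 𝔭.intValuation N ≠ 0 := 𝔭.intValuation_ne_zero N hN
  -- Three successive approximations: `x ∈ F` by density in the completion, then `a ∈ R` close to
  -- `x` at `𝔭`, then `r ∈ R` by the Chinese remainder theorem.
  obtain ⟨x, hx⟩ : ∃ x : F, Valued.v (c - algebraMap F (𝔭.adicCompletion F) x) ≤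
      𝔭.intValuation N := by
    have hopen : IsOpen {y : 𝔭.adicCompletion F | Valued.v (y - c) ≤ 𝔭.intValuation N} := by
      have h := (Valued.isOpen_integer (𝔭.adicCompletion F)).preimage
        (f := fun y => (algebraMap R (𝔭.adicCompletion F) N)⁻¹ * (y - c)) (by fun_prop)
      convert h using 1
      ext y
      rw [Set.mem_preimage, SetLike.mem_coe, Valuation.mem_integer_iff, map_mul, map_inv₀,
        valued_algebraMap_of_base, inv_mul_le_one₀ (zero_lt_iff.2 hN0)]
      rfl
    obtain ⟨x, hx⟩ := (HeightOneSpectrum.denseRange_algebraMap F 𝔭).exists_mem_open hopen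
      ⟨c, by simp⟩
    exact ⟨x, by rw [Valuation.map_sub_swap]; exact hx⟩
  have hx1 : 𝔭.valuation F x ≤ 1 := by
    rw [← valued_algebraMap, ← sub_sub_cancel c (algebraMap F (𝔭.adicCompletion F) x)]
    exact (Valuation.map_sub _ _ _).trans (max_le hc (hx.trans (𝔭.intValuation_le_one N)))
  obtain ⟨a, ha⟩ := 𝔭.exists_valuation_sub_lt_of_integer hx1 (Units.mk0 _ hN0)
  have ha' : Valued.v (c - algebraMap R (𝔭.adicCompletion F) a) ≤ 𝔭.intValuation N := by
    have h1 : c - algebraMap R (𝔭.adicCompletion F) a =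
        (c - algebraMap F (𝔭.adicCompletion F) x) -
          algebraMap F (𝔭.adicCompletion F) (algebraMap R F a - x) := by
      rw [map_sub, ← IsScalarTower.algebraMap_apply]; ring
    rw [h1]
    refine (Valuation.map_sub _ _ _).trans (max_le hx ?_)
    rw [valued_algebraMap]
    exact ha.le
  have hexp : ∀ 𝔮 : HeightOneSpectrum R, ∃ n : ℕ, 𝔮.intValuation N = WithZero.exp (-(n : ℤ)) :=
    fun 𝔮 => ⟨_, 𝔮.intValuation_if_neg hN⟩
  choose e he using hexp
  -- The congruences are `r ≡ a` at `𝔭` and `r ≡ 0` at the other prime divisors of `N`. Elsewhere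
  -- `N` is a unit and nothing is required.
  let s : Finset (HeightOneSpectrum R) := insert 𝔭 (finite_setOf_mem hN).toFinset
  obtain ⟨r, hr⟩ := IsDedekindDomain.exists_forall_sub_mem_ideal (s := s)
    (fun 𝔮 => 𝔮.asIdeal) e (fun 𝔮 _ => 𝔮.prime)
    (fun 𝔮 _ 𝔮' _ h h' => h (HeightOneSpectrum.ext h')) (fun 𝔮 => if 𝔮.1 = 𝔭 then a else 0)
  refine ⟨r, ?_, fun 𝔮 hq => ?_⟩
  · have h1 := hr 𝔭 (by simp [s])
    rw [if_pos rfl, ← HeightOneSpectrum.intValuation_le_pow_iff_mem, ← he,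
      ← valued_algebraMap_of_base (F := F)] at h1
    have h2 : c - algebraMap R (𝔭.adicCompletion F) r =
        (c - algebraMap R (𝔭.adicCompletion F) a) - algebraMap R (𝔭.adicCompletion F) (r - a) := by
      rw [map_sub]; ring
    rw [h2]
    exact (Valuation.map_sub _ _ _).trans (max_le ha' h1)
  · by_cases hqN : N ∈ 𝔮.asIdeal
    · have h1 := hr 𝔮 (by simp [s, hqN])
      rwa [if_neg hq, sub_zero, ← HeightOneSpectrum.intValuation_le_pow_iff_mem, ← he] at h1
    · rw [HeightOneSpectrum.intValuation_eq_one_iff.2 hqN]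
      exact 𝔮.intValuation_le_one r

end Places

/-! ### The correspondence between lattices and families of local lattices. -/

section LocalLattices

variable {R : Type*} [CommRing R] [IsDedekindDomain R]
  {F : Type*} [Field F] [Algebra R F] [IsFractionRing R F]
  {V : Type*} [AddCommGroup V] [Module F V] [Module R V] [IsScalarTower R F V]

theorem smul_mem_of_valued_le_one {𝔭 : HeightOneSpectrum R} {W : Type*} [AddCommGroup W]
    [Module (𝔭.adicCompletion F) W]
    (M : Submodule (𝔭.adicCompletionIntegers F) W) {c : 𝔭.adicCompletion F}
    (hc : Valued.v c ≤ 1) {m : W} (hm : m ∈ M) : c • m ∈ M :=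
  M.smul_mem (⟨c, hc⟩ : 𝔭.adicCompletionIntegers F) hm

theorem algebraMap_smul_mem {𝔭 : HeightOneSpectrum R} {W : Type*} [AddCommGroup W]
    [Module (𝔭.adicCompletion F) W]
    (M : Submodule (𝔭.adicCompletionIntegers F) W) (r : R) {m : W} (hm : m ∈ M) :
    algebraMap R (𝔭.adicCompletion F) r • m ∈ M :=
  smul_mem_of_valued_le_one M (by
    rw [valued_algebraMap_of_base]; exact 𝔭.intValuation_le_one r) hm

/-- Scalars of `R` outside `𝔭` can be cancelled in modules over the completion. -/
theorem mem_of_algebraMap_smul_mem {𝔭 : HeightOneSpectrum R} {W : Type*} [AddCommGroup W]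
    [Module (𝔭.adicCompletion F) W]
    (M : Submodule (𝔭.adicCompletionIntegers F) W) {r : R} (hr : r ∉ 𝔭.asIdeal) {m : W}
    (hm : algebraMap R (𝔭.adicCompletion F) r • m ∈ M) : m ∈ M := by
  have hval : Valued.v (algebraMap R (𝔭.adicCompletion F) r) = 1 := by
    rw [valued_algebraMap_of_base, HeightOneSpectrum.intValuation_eq_one_iff.2 hr]
  have hne : algebraMap R (𝔭.adicCompletion F) r ≠ 0 := by
    rw [← Valuation.ne_zero_iff Valued.v, hval]
    exact one_ne_zero
  have h := smul_mem_of_valued_le_one M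
    (c := (algebraMap R (𝔭.adicCompletion F) r)⁻¹) (by rw [map_inv₀, hval, inv_one]) hm
  rwa [smul_smul, inv_mul_cancel₀ hne, one_smul] at h

theorem algebraMap_smul_one_tmul (𝔭 : HeightOneSpectrum R) (r : R) (x : V) :
    algebraMap R (𝔭.adicCompletion F) r • ((1 : 𝔭.adicCompletion F) ⊗ₜ[F] x) = 1 ⊗ₜ[F] (r • x) := by
  rw [← algebraMap_smul F r x, ← TensorProduct.smul_tmul, TensorProduct.smul_tmul',
    IsScalarTower.algebraMap_apply R F, smul_eq_mul, mul_one, Algebra.algebraMap_eq_smul_one]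

theorem one_tmul_mem_localLattice {L : Submodule R V} (𝔭 : HeightOneSpectrum R) {x : V}
    (hx : x ∈ L) : (1 : 𝔭.adicCompletion F) ⊗ₜ[F] x ∈ localLattice (F := F) L 𝔭 :=
  Submodule.subset_span ⟨x, hx, rfl⟩

theorem algebraMap_smul_mem_localLattice {K L : Submodule R V} {d : R} (h : ∀ x ∈ K, d • x ∈ L)
    {𝔭 : HeightOneSpectrum R} {m : LocalSpace F V 𝔭} (hm : m ∈ localLattice K 𝔭) :
    algebraMap R (𝔭.adicCompletion F) d • m ∈ localLattice L 𝔭 := by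
  induction hm using Submodule.span_induction with
  | mem m hm =>
    obtain ⟨x, hx, rfl⟩ := hm
    rw [algebraMap_smul_one_tmul]
    exact one_tmul_mem_localLattice 𝔭 (h x hx)
  | zero => simp
  | add m n _ _ hm hn => rw [smul_add]; exact add_mem hm hn
  | smul c m _ hm => rw [smul_comm]; exact Submodule.smul_mem _ c hm

theorem eq_algebraMap_smul_of_le {𝔭 : HeightOneSpectrum R} {W : Type*} [AddCommGroup W]
    [Module (𝔭.adicCompletion F) W]
    (M : Submodule (𝔭.adicCompletionIntegers F) W) {c : 𝔭.adicCompletion F} {N : R} (hN : N ≠ 0)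
    (hc : Valued.v c ≤ 𝔭.intValuation N) {m : W} (hm : m ∈ M) :
    ∃ n ∈ M, c • m = algebraMap R (𝔭.adicCompletion F) N • n := by
  have h0 : algebraMap R (𝔭.adicCompletion F) N ≠ 0 := by
    rw [← Valuation.ne_zero_iff Valued.v, valued_algebraMap_of_base]
    exact 𝔭.intValuation_ne_zero N hN
  refine ⟨((algebraMap R (𝔭.adicCompletion F) N)⁻¹ * c) • m, smul_mem_of_valued_le_one M ?_ hm, ?_⟩
  · rw [map_mul, map_inv₀, valued_algebraMap_of_base]
    exact inv_mul_le_one_of_le₀ hc zero_le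
  · rw [smul_smul, mul_inv_cancel_left₀ h0]

/-- Elements of `L_𝔭` are approximated by elements of `L` that are small at the other places. -/
theorem exists_approx_localLattice (L : Submodule R V) {𝔭 : HeightOneSpectrum R}
    {m : LocalSpace F V 𝔭} (hm : m ∈ localLattice L 𝔭) {N : R} (hN : N ≠ 0) :
    ∃ y ∈ L, (∃ n ∈ localLattice L 𝔭,
        m = 1 ⊗ₜ[F] y + algebraMap R (𝔭.adicCompletion F) N • n) ∧
      ∀ 𝔮 : HeightOneSpectrum R, 𝔮 ≠ 𝔭 → ∃ n ∈ localLattice (F := F) L 𝔮,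
        (1 : 𝔮.adicCompletion F) ⊗ₜ[F] y = algebraMap R (𝔮.adicCompletion F) N • n := by
  have key : ∀ c : 𝔭.adicCompletion F, Valued.v c ≤ 1 → ∀ x ∈ L, ∃ y ∈ L,
      (∃ n ∈ localLattice L 𝔭, c • ((1 : 𝔭.adicCompletion F) ⊗ₜ[F] x) =
        1 ⊗ₜ[F] y + algebraMap R (𝔭.adicCompletion F) N • n) ∧
      ∀ 𝔮 : HeightOneSpectrum R, 𝔮 ≠ 𝔭 → ∃ n ∈ localLattice (F := F) L 𝔮,
        (1 : 𝔮.adicCompletion F) ⊗ₜ[F] y = algebraMap R (𝔮.adicCompletion F) N • n := by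
    intro c hc x hx
    obtain ⟨r, hr, hr'⟩ := exists_approx 𝔭 hc hN
    refine ⟨r • x, L.smul_mem r hx, ?_, fun 𝔮 hq => ?_⟩
    · obtain ⟨n, hn, h⟩ := eq_algebraMap_smul_of_le _ hN hr (one_tmul_mem_localLattice 𝔭 hx)
      refine ⟨n, hn, ?_⟩
      rw [← h, ← algebraMap_smul_one_tmul, ← add_smul, add_sub_cancel]
    · rw [← algebraMap_smul_one_tmul]
      exact eq_algebraMap_smul_of_le _ hN (by rw [valued_algebraMap_of_base]; exact hr' 𝔮 hq)
        (one_tmul_mem_localLattice 𝔮 hx)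
  induction hm using Submodule.span_induction with
  | mem m hm =>
    obtain ⟨x, hx, rfl⟩ := hm
    obtain ⟨y, hy, h⟩ := key 1 (by simp) x hx
    rw [one_smul] at h
    exact ⟨y, hy, h⟩
  | zero => exact ⟨0, L.zero_mem, ⟨0, zero_mem _, by simp⟩, fun 𝔮 _ => ⟨0, zero_mem _, by simp⟩⟩
  | add m m' _ _ hm hm' =>
    obtain ⟨y, hy, ⟨n, hn, h⟩, hq⟩ := hm
    obtain ⟨y', hy', ⟨n', hn', h'⟩, hq'⟩ := hm'
    refine ⟨y + y', add_mem hy hy', ⟨n + n', add_mem hn hn', ?_⟩, fun 𝔮 h𝔮 => ?_⟩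
    · rw [h, h', TensorProduct.tmul_add, smul_add]; abel
    · obtain ⟨k, hk, e⟩ := hq 𝔮 h𝔮
      obtain ⟨k', hk', e'⟩ := hq' 𝔮 h𝔮
      exact ⟨k + k', add_mem hk hk', by rw [TensorProduct.tmul_add, e, e', smul_add]⟩
  -- Only the approximation of `m` by `y` at `𝔭` is kept; `c • y` is approximated afresh, which
  -- restores smallness at the other places.
  | smul c m _ hm =>
    obtain ⟨y, hy, ⟨n, hn, h⟩, -⟩ := hm
    obtain ⟨y', hy', ⟨n', hn', h'⟩, hq'⟩ := key c c.2 y hy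
    refine ⟨y', hy', ⟨c • n + n', add_mem (Submodule.smul_mem _ c hn) hn', ?_⟩, hq'⟩
    change (c : 𝔭.adicCompletion F) • m = _
    rw [h, smul_add, h', smul_add, smul_comm (c : 𝔭.adicCompletion F)]
    change _ = _ + (_ • ((c : 𝔭.adicCompletion F) • n) + _)
    abel

variable [FiniteDimensional F V]

/-- The ideal of all `r` with `r • x ∈ K` lies in no maximal ideal. At a given `𝔭`, `x` is close to
some `y ∈ K`, and the coordinates of `x - y` in a free lattice show that some `s ∉ 𝔭` carries it
into `K`. -/
theorem mem_of_forall_mem_localLattice {K : Submodule R V} (hK : Submodule.IsLattice F K) {x : V}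
    (hx : ∀ 𝔭 : HeightOneSpectrum R, (1 : 𝔭.adicCompletion F) ⊗ₜ[F] x ∈ localLattice K 𝔭) :
    x ∈ K := by
  classical
  let b := Module.finBasis F V
  let M : Submodule R V := Submodule.span R (Set.range b)
  have hM : Submodule.span F (M : Set V) = ⊤ := by
    rw [eq_top_iff, ← b.span_eq]
    exact Submodule.span_mono Submodule.subset_span
  obtain ⟨e, he, heK⟩ := exists_smul_le hK.fg hM
  obtain ⟨d, hd, hdM⟩ := exists_smul_le (F := F) (A := M) (B := K)
    (Submodule.fg_span (Set.finite_range b)) hK.span_eq_top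
  let I : Ideal R := K.comap (LinearMap.toSpanSingleton R V x)
  have hI : ∀ r, r ∈ I ↔ r • x ∈ K := fun r => Iff.rfl
  suffices h : I = ⊤ by simpa using (hI 1).1 (h ▸ Submodule.mem_top)
  by_contra hne
  obtain ⟨P, hP, hIP⟩ := I.exists_le_maximal hne
  obtain ⟨a, ha, hax⟩ := exists_smul_mem_of_span_eq_top hK.span_eq_top x
  have hPbot : P ≠ ⊥ := by
    rintro rfl
    exact ha (by simpa using hIP ((hI a).2 hax))
  let 𝔭 : HeightOneSpectrum R := ⟨P, hP.isPrime, hPbot⟩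
  suffices h : ∃ s ∉ P, s • x ∈ K by
    obtain ⟨s, hs, hsx⟩ := h
    exact hs (hIP ((hI s).2 hsx))
  -- The modulus is `d * e` because `e` carries `K` into the free lattice `M`, where divisibility is
  -- read off coordinates, and `d` carries `M` back into `K`.
  obtain ⟨y, hy, ⟨n, hn, hxy⟩, -⟩ := exists_approx_localLattice K (hx 𝔭) (mul_ne_zero hd he)
  have hcoord : ∀ m ∈ localLattice (F := F) M 𝔭, ∀ i,
      Valued.v ((b.baseChange (𝔭.adicCompletion F)).repr m i) ≤ 1 := by
    intro m hm i
    induction hm using Submodule.span_induction with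
    | mem m hm =>
      obtain ⟨z, hz, rfl⟩ := hm
      have : ∃ r : R, b.repr z i = algebraMap R F r := by
        have hz' := b.mem_span_iff_repr_mem R z |>.1 hz i
        exact hz'.imp fun _ h => h.symm
      obtain ⟨r, hr⟩ := this
      rw [Module.Basis.baseChange_repr_tmul, hr, algebraMap_smul, Algebra.smul_def, mul_one,
        valued_algebraMap_of_base]
      exact 𝔭.intValuation_le_one r
    | zero => simp
    | add m m' _ _ hm hm' =>
      rw [map_add, Finsupp.add_apply]
      exact (Valuation.map_add _ _ _).trans (max_le hm hm')
    | smul c m _ hm =>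
      change Valued.v ((b.baseChange (𝔭.adicCompletion F)).repr ((c : 𝔭.adicCompletion F) • m) i) ≤ 1
      rw [map_smul, Finsupp.smul_apply, smul_eq_mul, map_mul]
      exact mul_le_one' c.2 hm
  have hz : ∀ i, 𝔭.valuation F (b.repr (x - y) i) ≤ 𝔭.intValuation d := by
    intro i
    have h1 : (1 : 𝔭.adicCompletion F) ⊗ₜ[F] (x - y) = algebraMap R (𝔭.adicCompletion F) d •
        algebraMap R (𝔭.adicCompletion F) e • n := by
      rw [TensorProduct.tmul_sub, hxy, add_sub_cancel_left, map_mul, mul_smul]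
    have h2 := congrArg (fun w => (b.baseChange (𝔭.adicCompletion F)).repr w i) h1
    simp only [map_smul, Finsupp.smul_apply] at h2
    have h3 := hcoord _ (algebraMap_smul_mem_localLattice heK hn) i
    rw [map_smul, Finsupp.smul_apply] at h3
    rw [Module.Basis.baseChange_repr_tmul, Algebra.smul_def, mul_one] at h2
    rw [← valued_algebraMap, h2, smul_eq_mul, map_mul, valued_algebraMap_of_base]
    exact mul_le_of_le_one_right' h3
  -- The coordinates of `x - y` are `d` times `𝔭`-integral elements of `F`, so they have
  -- denominators outside `𝔭`.
  have hs : ∀ i, ∃ s : 𝔭.asIdeal.primeCompl, ∃ r : R,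
      b.repr (x - y) i * algebraMap R F s = algebraMap R F (d * r) := by
    intro i
    have hd' : algebraMap R F d ≠ 0 := by simpa using hd
    obtain ⟨r, s, hrs⟩ := 𝔭.exists_primeCompl_mul_eq_of_integer
      (b.repr (x - y) i / algebraMap R F d) (by
        rw [map_div₀, HeightOneSpectrum.valuation_of_algebraMap]
        exact div_le_one_of_le₀ (hz i) zero_le)
    refine ⟨s, r, ?_⟩
    rw [map_mul, ← hrs]
    field_simp
  choose s r hsr using hs
  refine ⟨∏ i, (s i : R), ?_, ?_⟩
  · have h := (∏ i, s i).2
    rwa [Submonoid.coe_finsetProd] at h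
  · have hzK : (∏ i, (s i : R)) • (x - y) ∈ K := by
      rw [← b.sum_repr (x - y), Finset.smul_sum]
      refine Submodule.sum_mem _ fun i _ => ?_
      rw [← Finset.prod_erase_mul _ _ (Finset.mem_univ i), mul_smul, ← algebraMap_smul F (s i : R),
        smul_smul, mul_comm (algebraMap R F _), hsr, algebraMap_smul, mul_comm d, mul_smul]
      exact K.smul_mem _ (K.smul_mem _ (hdM _ (Submodule.subset_span ⟨i, rfl⟩)))
    have := add_mem hzK (K.smul_mem (∏ i, (s i : R)) hy)
    rwa [← smul_add, sub_add_cancel] at this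

theorem eq_of_localLattice_eq {K K' : Submodule R V} (hK : Submodule.IsLattice F K)
    (hK' : Submodule.IsLattice F K')
    (h : ∀ 𝔭 : HeightOneSpectrum R, localLattice (F := F) K 𝔭 = localLattice K' 𝔭) : K = K' :=
  le_antisymm
    (fun _ hx => mem_of_forall_mem_localLattice hK' fun 𝔭 => h 𝔭 ▸ one_tmul_mem_localLattice 𝔭 hx)
    (fun _ hx => mem_of_forall_mem_localLattice hK fun 𝔭 =>
      (h 𝔭).symm ▸ one_tmul_mem_localLattice 𝔭 hx)

/-- A family of local lattices with bounded denominators relative to a global lattice comes from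
a global lattice. -/
theorem exists_isLattice_of_local {L : Submodule R V} (hL : Submodule.IsLattice F L)
    (M : ∀ 𝔭 : HeightOneSpectrum R,
      Submodule (𝔭.adicCompletionIntegers F) (LocalSpace F V 𝔭)) {d : R} (hd : d ≠ 0)
    (hLM : ∀ 𝔭, ∀ m ∈ localLattice L 𝔭, algebraMap R (𝔭.adicCompletion F) d • m ∈ M 𝔭)
    (hML : ∀ 𝔭, ∀ m ∈ M 𝔭, algebraMap R (𝔭.adicCompletion F) d • m ∈ localLattice L 𝔭) :
    ∃ K : Submodule R V, Submodule.IsLattice F K ∧ ∀ 𝔭, localLattice K 𝔭 = M 𝔭 := by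
  -- The only candidate: the vectors of `V` lying in every `M 𝔭`. It is a lattice because `dL ⊆ K`
  -- and `dK ⊆ L`.
  let K : Submodule R V :=
    { carrier := {x | ∀ 𝔭 : HeightOneSpectrum R, (1 : 𝔭.adicCompletion F) ⊗ₜ[F] x ∈ M 𝔭}
      add_mem' := fun hx hy 𝔭 => by
        rw [TensorProduct.tmul_add]; exact add_mem (hx 𝔭) (hy 𝔭)
      zero_mem' := fun 𝔭 => by rw [TensorProduct.tmul_zero]; exact zero_mem _
      smul_mem' := fun r x hx 𝔭 => by
        rw [← algebraMap_smul_one_tmul]; exact algebraMap_smul_mem _ r (hx 𝔭) }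
  have hmem : ∀ x, x ∈ K ↔ ∀ 𝔭 : HeightOneSpectrum R, (1 : 𝔭.adicCompletion F) ⊗ₜ[F] x ∈ M 𝔭 :=
    fun _ => Iff.rfl
  have hdL : ∀ x ∈ L, d • x ∈ K := fun x hx 𝔭 => by
    rw [← algebraMap_smul_one_tmul]
    exact hLM 𝔭 _ (one_tmul_mem_localLattice 𝔭 hx)
  have hdK : ∀ x ∈ K, d • x ∈ L := fun x hx =>
    mem_of_forall_mem_localLattice hL fun 𝔭 => by
      rw [← algebraMap_smul_one_tmul]
      exact hML 𝔭 _ (hx 𝔭)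
  have hdF : algebraMap R F d ≠ 0 := by simpa using hd
  refine ⟨K, ⟨?_, ?_⟩, fun 𝔭 => le_antisymm ?_ ?_⟩
  · have : Module.Finite R L := Module.Finite.iff_fg.2 hL.fg
    let φ : K →ₗ[R] L := ((LinearMap.lsmul R V d).restrict hdK)
    have hφ : Function.Injective φ := by
      intro x y hxy
      have h1 : d • (x : V) = d • (y : V) := congrArg Subtype.val hxy
      rw [← algebraMap_smul F d, ← algebraMap_smul F d (y : V)] at h1
      exact Subtype.ext (smul_right_injective V hdF h1)
    exact Module.Finite.iff_fg.1 (Module.Finite.of_injective φ hφ)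
  · rw [eq_top_iff, ← hL.span_eq_top, Submodule.span_le]
    intro x hx
    have h1 := Submodule.smul_mem (Submodule.span F (K : Set V)) (algebraMap R F d)⁻¹
      (Submodule.subset_span (hdL x hx))
    rwa [← algebraMap_smul F d, smul_smul, inv_mul_cancel₀ hdF, one_smul] at h1
  · rw [localLattice, Submodule.span_le]
    rintro _ ⟨x, hx, rfl⟩
    exact hx 𝔭
  · intro m hm
    have hdd : ∀ 𝔮 : HeightOneSpectrum R, algebraMap R (𝔮.adicCompletion F) d ≠ 0 := fun 𝔮 => by
      rw [← Valuation.ne_zero_iff Valued.v, valued_algebraMap_of_base]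
      exact 𝔮.intValuation_ne_zero d hd
    -- The modulus is `d²` because `m` will be approximated by `y / d`: one factor `d` is lost in
    -- the division, the other carries `L` into `K` and each `L_𝔮` into `M 𝔮`.
    obtain ⟨y, hy, ⟨n, hn, h⟩, hq⟩ :=
      exists_approx_localLattice L (hML 𝔭 m hm) (mul_ne_zero hd hd)
    have hsmul : ∀ 𝔮 : HeightOneSpectrum R, algebraMap R (𝔮.adicCompletion F) d •
        ((1 : 𝔮.adicCompletion F) ⊗ₜ[F] ((algebraMap R F d)⁻¹ • y)) = 1 ⊗ₜ[F] y := fun 𝔮 => by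
      rw [algebraMap_smul_one_tmul, ← algebraMap_smul F d, smul_smul, mul_inv_cancel₀ hdF, one_smul]
    have hm' : m = 1 ⊗ₜ[F] ((algebraMap R F d)⁻¹ • y) +
        algebraMap R (𝔭.adicCompletion F) d • n := by
      apply smul_right_injective _ (hdd 𝔭)
      beta_reduce
      rw [smul_add, hsmul, h, map_mul, mul_smul]
    have hyK : (algebraMap R F d)⁻¹ • y ∈ K := by
      intro 𝔮
      by_cases h𝔮 : 𝔮 = 𝔭
      · subst h𝔮
        rw [eq_sub_of_add_eq hm'.symm]
        exact sub_mem hm (hLM _ _ hn)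
      · obtain ⟨k, hk, e⟩ := hq 𝔮 h𝔮
        have : (1 : 𝔮.adicCompletion F) ⊗ₜ[F] ((algebraMap R F d)⁻¹ • y) =
            algebraMap R (𝔮.adicCompletion F) d • k := by
          apply smul_right_injective _ (hdd 𝔮)
          beta_reduce
          rw [hsmul, e, map_mul, mul_smul]
        rw [this]
        exact hLM 𝔮 k hk
    rw [hm']
    exact add_mem (one_tmul_mem_localLattice 𝔭 hyK) (algebraMap_smul_mem_localLattice hdL hn)

-- Every element of the completion becomes integral after multiplication by a nonzero element of
-- `R`, so denominators can be taken in `R`.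
omit [FiniteDimensional F V] in
theorem exists_smul_mem_localLattice {L : Submodule R V} (hL : Submodule.IsLattice F L)
    (𝔭 : HeightOneSpectrum R) (w : LocalSpace F V 𝔭) :
    ∃ d : R, d ≠ 0 ∧ algebraMap R (𝔭.adicCompletion F) d • w ∈ localLattice L 𝔭 := by
  induction w using TensorProduct.induction_on with
  | zero => exact ⟨1, one_ne_zero, by simp⟩
  | tmul c x =>
    obtain ⟨d, hd, hdx⟩ := exists_smul_mem_of_span_eq_top hL.span_eq_top x
    obtain ⟨b, hb, hbc⟩ :=
      HeightOneSpectrum.adicCompletion.mul_nonZeroDivisor_mem_adicCompletionIntegers 𝔭 c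
    refine ⟨b * d, mul_ne_zero (nonZeroDivisors.ne_zero hb) hd, ?_⟩
    have h1 : algebraMap R (𝔭.adicCompletion F) (b * d) • (c ⊗ₜ[F] x) =
        (c * algebraMap R (𝔭.adicCompletion F) b) • ((1 : 𝔭.adicCompletion F) ⊗ₜ[F] (d • x)) := by
      rw [← algebraMap_smul_one_tmul, smul_smul, TensorProduct.smul_tmul',
        TensorProduct.smul_tmul', map_mul]
      congr 1
      simp only [smul_eq_mul]
      ring
    rw [h1]
    exact smul_mem_of_valued_le_one _ hbc (one_tmul_mem_localLattice 𝔭 hdx)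
  | add x y hx hy =>
    obtain ⟨d, hd, hdx⟩ := hx
    obtain ⟨e, he, hey⟩ := hy
    refine ⟨d * e, mul_ne_zero hd he, ?_⟩
    rw [smul_add, map_mul]
    refine add_mem ?_ ?_
    · rw [mul_comm, mul_smul]; exact algebraMap_smul_mem _ _ hdx
    · rw [mul_smul]; exact algebraMap_smul_mem _ _ hey

omit [FiniteDimensional F V] in
theorem exists_smul_map_le {L : Submodule R V} (hL : Submodule.IsLattice F L)
    (𝔭 : HeightOneSpectrum R)
    (σ : LocalSpace F V 𝔭 →ₗ[𝔭.adicCompletion F] LocalSpace F V 𝔭) :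
    ∃ d : R, d ≠ 0 ∧ ∀ m ∈ localLattice L 𝔭,
      algebraMap R (𝔭.adicCompletion F) d • σ m ∈ localLattice L 𝔭 := by
  classical
  obtain ⟨s, hs⟩ := hL.fg
  choose d hd hdm using fun x : V =>
    exists_smul_mem_localLattice hL 𝔭 (σ ((1 : 𝔭.adicCompletion F) ⊗ₜ[F] x))
  refine ⟨∏ x ∈ s, d x, Finset.prod_ne_zero_iff.2 fun x _ => hd x, fun m hm => ?_⟩
  induction hm using Submodule.span_induction with
  | mem m hm =>
    obtain ⟨x, hx, rfl⟩ := hm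
    rw [SetLike.mem_coe, ← hs] at hx
    beta_reduce
    induction hx using Submodule.span_induction with
    | mem x hx =>
      rw [← Finset.prod_erase_mul _ _ hx, map_mul, mul_smul]
      exact algebraMap_smul_mem _ _ (hdm x)
    | zero => simp
    | add x y _ _ hx hy => rw [TensorProduct.tmul_add, map_add, smul_add]; exact add_mem hx hy
    | smul c x _ hx =>
      rw [← algebraMap_smul_one_tmul, map_smul, smul_comm]
      exact algebraMap_smul_mem _ _ hx
  | zero => simp
  | add m n _ _ hm hn => rw [map_add, smul_add]; exact add_mem hm hn
  | smul c m _ hm =>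
    change _ • σ ((c : 𝔭.adicCompletion F) • m) ∈ _
    rw [map_smul, smul_comm]
    exact Submodule.smul_mem _ c hm

theorem mem_mapLocal {𝔭 : HeightOneSpectrum R}
    {σ : LocalSpace F V 𝔭 ≃ₗ[𝔭.adicCompletion F] LocalSpace F V 𝔭}
    {M : Submodule (𝔭.adicCompletionIntegers F) (LocalSpace F V 𝔭)} {m : LocalSpace F V 𝔭} :
    m ∈ mapLocal σ M ↔ ∃ n ∈ M, σ n = m :=
  Iff.rfl

/-- An adelic family of automorphisms moves a lattice to a lattice. -/
theorem exists_isLattice_mapLocal {L : Submodule R V} (hL : Submodule.IsLattice F L)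
    (σ : ∀ 𝔭 : HeightOneSpectrum R,
      LocalSpace F V 𝔭 ≃ₗ[𝔭.adicCompletion F] LocalSpace F V 𝔭)
    (hσ : {𝔭 | mapLocal (σ 𝔭) (localLattice L 𝔭) ≠ localLattice L 𝔭}.Finite) :
    ∃ K : Submodule R V, Submodule.IsLattice F K ∧
      ∀ 𝔭, localLattice K 𝔭 = mapLocal (σ 𝔭) (localLattice L 𝔭) := by
  classical
  choose d hd hdm using fun 𝔭 => exists_smul_map_le hL 𝔭 (σ 𝔭).toLinearMap
  choose e he hem using fun 𝔭 => exists_smul_map_le hL 𝔭 (σ 𝔭).symm.toLinearMap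
  -- Denominators of `σ` and `σ⁻¹` matter only at the finitely many places where `L_𝔭` moves; one
  -- product bounds them all.
  have hprod : ∏ 𝔭 ∈ hσ.toFinset, (d 𝔭 * e 𝔭) ≠ 0 :=
    Finset.prod_ne_zero_iff.2 fun 𝔭 _ => mul_ne_zero (hd 𝔭) (he 𝔭)
  refine exists_isLattice_of_local hL _ hprod (fun 𝔭 m hm => ?_) (fun 𝔭 m hm => ?_)
  · by_cases h : mapLocal (σ 𝔭) (localLattice L 𝔭) = localLattice L 𝔭
    · rw [h]; exact algebraMap_smul_mem _ _ hm
    · rw [← Finset.prod_erase_mul _ _ (hσ.mem_toFinset.2 h), ← mul_assoc, map_mul, mul_smul]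
      refine algebraMap_smul_mem _ _ (mem_mapLocal.2 ⟨_, hem 𝔭 m hm, ?_⟩)
      rw [map_smul]
      simp
  · by_cases h : mapLocal (σ 𝔭) (localLattice L 𝔭) = localLattice L 𝔭
    · rw [h] at hm; exact algebraMap_smul_mem _ _ hm
    · obtain ⟨n, hn, rfl⟩ := mem_mapLocal.1 hm
      rw [← Finset.prod_erase_mul _ _ (hσ.mem_toFinset.2 h), mul_comm (d 𝔭), ← mul_assoc, map_mul,
        mul_smul]
      exact algebraMap_smul_mem _ _ (hdm 𝔭 n hn)

end LocalLattices

/-! ### Action of automorphisms on lattices, globally and locally. -/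

section LinearAutomorphisms

variable {R : Type*} [CommRing R] [IsDedekindDomain R]
  {F : Type*} [Field F] [Algebra R F] [IsFractionRing R F]
  {V : Type*} [AddCommGroup V] [Module F V]

/-- The localization of an automorphism of `V` at a place. -/
noncomputable def localize (𝔭 : HeightOneSpectrum R) (σ : V ≃ₗ[F] V) :
    LocalSpace F V 𝔭 ≃ₗ[𝔭.adicCompletion F] LocalSpace F V 𝔭 :=
  σ.baseChange F (𝔭.adicCompletion F) V V

theorem localize_tmul (𝔭 : HeightOneSpectrum R) (σ : V ≃ₗ[F] V) (c : 𝔭.adicCompletion F) (x : V) :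
    localize 𝔭 σ (c ⊗ₜ[F] x) = c ⊗ₜ[F] σ x :=
  rfl

theorem coe_localize (𝔭 : HeightOneSpectrum R) (σ : V ≃ₗ[F] V) :
    (localize 𝔭 σ : LocalSpace F V 𝔭 →ₗ[𝔭.adicCompletion F] LocalSpace F V 𝔭) =
      (σ : V →ₗ[F] V).baseChange (𝔭.adicCompletion F) :=
  rfl

theorem mapLocal_mul {𝔭 : HeightOneSpectrum R}
    (σ τ : LocalSpace F V 𝔭 ≃ₗ[𝔭.adicCompletion F] LocalSpace F V 𝔭)
    (M : Submodule (𝔭.adicCompletionIntegers F) (LocalSpace F V 𝔭)) :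
    mapLocal (σ * τ) M = mapLocal σ (mapLocal τ M) :=
  Submodule.map_comp (τ.toLinearMap.restrictScalars (𝔭.adicCompletionIntegers F))
    (σ.toLinearMap.restrictScalars (𝔭.adicCompletionIntegers F)) M

theorem mapLocal_one {𝔭 : HeightOneSpectrum R}
    (M : Submodule (𝔭.adicCompletionIntegers F) (LocalSpace F V 𝔭)) :
    mapLocal (1 : LocalSpace F V 𝔭 ≃ₗ[𝔭.adicCompletion F] LocalSpace F V 𝔭) M = M :=
  Submodule.map_id M

theorem mapLocal_inv_mapLocal {𝔭 : HeightOneSpectrum R}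
    (σ : LocalSpace F V 𝔭 ≃ₗ[𝔭.adicCompletion F] LocalSpace F V 𝔭)
    (M : Submodule (𝔭.adicCompletionIntegers F) (LocalSpace F V 𝔭)) :
    mapLocal σ⁻¹ (mapLocal σ M) = M := by
  rw [← mapLocal_mul, inv_mul_cancel, mapLocal_one]

theorem mapLocal_inv_eq {𝔭 : HeightOneSpectrum R}
    {σ : LocalSpace F V 𝔭 ≃ₗ[𝔭.adicCompletion F] LocalSpace F V 𝔭}
    {M N : Submodule (𝔭.adicCompletionIntegers F) (LocalSpace F V 𝔭)} (h : mapLocal σ M = N) :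
    mapLocal σ⁻¹ N = M := by
  rw [← h, mapLocal_inv_mapLocal]

theorem mapLocal_span {𝔭 : HeightOneSpectrum R}
    (σ : LocalSpace F V 𝔭 ≃ₗ[𝔭.adicCompletion F] LocalSpace F V 𝔭) (s : Set (LocalSpace F V 𝔭)) :
    mapLocal σ (Submodule.span _ s) = Submodule.span _ (σ '' s) :=
  Submodule.map_span _ s

variable [Module R V] [IsScalarTower R F V]

theorem localLattice_mapGlobal (σ : V ≃ₗ[F] V) (K : Submodule R V) (𝔭 : HeightOneSpectrum R) :
    localLattice (F := F) (mapGlobal σ K) 𝔭 = mapLocal (localize 𝔭 σ) (localLattice K 𝔭) := by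
  rw [localLattice, localLattice, mapLocal_span, Set.image_image]
  congr 1
  ext w
  constructor
  · rintro ⟨_, ⟨x, hx, rfl⟩, rfl⟩
    exact ⟨x, hx, rfl⟩
  · rintro ⟨x, hx, rfl⟩
    exact ⟨σ x, ⟨x, hx, rfl⟩, rfl⟩

theorem isLattice_mapGlobal (σ : V ≃ₗ[F] V) {K : Submodule R V} (hK : Submodule.IsLattice F K) :
    Submodule.IsLattice F (mapGlobal σ K) where
  fg := hK.fg.map _
  span_eq_top := by
    have h : ((mapGlobal σ K : Submodule R V) : Set V) = σ.toLinearMap '' K := rfl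
    rw [h, Submodule.span_image, hK.span_eq_top, Submodule.map_top]
    exact σ.range

end LinearAutomorphisms

/-! ### Passage of rotations and spinor norms to the completions. -/

section QuadraticSpaces

variable {R : Type*} [CommRing R] [IsDedekindDomain R]
  {F : Type*} [Field F] [Algebra R F] [IsFractionRing R F] [Invertible (2 : F)]
  {V : Type*} [AddCommGroup V] [Module F V] (f : QuadraticForm F V) (𝔭 : HeightOneSpectrum R)

theorem localForm_one_tmul (x : V) :
    localForm f 𝔭 (1 ⊗ₜ[F] x) = algebraMap F (𝔭.adicCompletion F) (f x) := by
  rw [localForm, QuadraticForm.baseChange_tmul, mul_one, Algebra.algebraMap_eq_smul_one]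

theorem polar_localForm_one_tmul (x y : V) :
    QuadraticMap.polar (localForm f 𝔭) ((1 : 𝔭.adicCompletion F) ⊗ₜ[F] x) (1 ⊗ₜ[F] y) =
      algebraMap F (𝔭.adicCompletion F) (QuadraticMap.polar f x y) := by
  simp only [QuadraticMap.polar, ← TensorProduct.tmul_add, localForm_one_tmul, map_sub]

theorem localize_mem_specialOrthogonal [FiniteDimensional F V] {f : QuadraticForm F V}
    {σ : V ≃ₗ[F] V} (hσ : σ ∈ specialOrthogonal f) :
    localize 𝔭 σ ∈ specialOrthogonal (localForm f 𝔭) := by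
  refine ⟨fun x => ?_, ?_⟩
  · have h : (localForm f 𝔭).comp (localize 𝔭 σ).toLinearMap = localForm f 𝔭 := by
      refine baseChange_ext fun m => ?_
      change localForm f 𝔭 (localize 𝔭 σ (1 ⊗ₜ[F] m)) = _
      rw [localize_tmul, localForm_one_tmul, localForm_one_tmul, hσ.1]
    exact congrArg (fun q => q x) h
  · rw [coe_localize, LinearMap.det_baseChange, hσ.2, map_one]

theorem symmetryAlong_one_tmul (u : V) :
    symmetryAlong (localForm f 𝔭) (1 ⊗ₜ[F] u) =
      (symmetryAlong f u).baseChange (𝔭.adicCompletion F) := by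
  refine TensorProduct.AlgebraTensorModule.curry_injective ?_
  ext x
  change symmetryAlong (localForm f 𝔭) (1 ⊗ₜ[F] u) (1 ⊗ₜ[F] x) = 1 ⊗ₜ[F] symmetryAlong f u x
  rw [symmetryAlong_apply, symmetryAlong_apply, localForm_one_tmul, polar_localForm_one_tmul,
    ← map_inv₀, ← map_mul, algebraMap_smul, TensorProduct.tmul_sub, TensorProduct.tmul_smul]

/-- Symmetries commute with base change, so a global word in anisotropic vectors is also a local
one. -/
theorem isSpinorNorm_localize {f : QuadraticForm F V} {σ : V ≃ₗ[F] V} {a : Fˣ}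
    (h : IsSpinorNorm f σ a) :
    IsSpinorNorm (localForm f 𝔭) (localize 𝔭 σ)
      (Units.map (algebraMap F (𝔭.adicCompletion F)).toMonoidHom a) := by
  obtain ⟨l, hl, hσ, c, hc⟩ := h
  refine ⟨l.map fun u => 1 ⊗ₜ[F] u, ?_, ?_,
    Units.map (algebraMap F (𝔭.adicCompletion F)).toMonoidHom c, ?_⟩
  · intro u hu
    obtain ⟨v, hv, rfl⟩ := List.mem_map.1 hu
    rw [localForm_one_tmul]
    simpa using hl v hv
  · rw [coe_localize, hσ, List.map_map]
    clear hσ hc hl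
    induction l with
    | nil => exact LinearMap.baseChange_one F V
    | cons u l ih =>
      rw [List.map_cons, List.map_cons, List.prod_cons, List.prod_cons, LinearMap.baseChange_mul,
        ih, Function.comp_apply, symmetryAlong_one_tmul]
  · have h1 : (l.map fun u => (1 : 𝔭.adicCompletion F) ⊗ₜ[F] u).map (localForm f 𝔭) =
        (l.map f).map (algebraMap F (𝔭.adicCompletion F)) := by
      rw [List.map_map, List.map_map]
      exact List.map_congr_left fun u _ => localForm_one_tmul f 𝔭 u
    rw [h1, ← map_list_prod]
    change algebraMap F (𝔭.adicCompletion F) a = algebraMap F (𝔭.adicCompletion F) c ^ 2 * _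
    rw [hc, map_mul, map_pow]

theorem exists_orthogonal_basis [FiniteDimensional F V] {f : QuadraticForm F V}
    (hf : f.Nondegenerate) :
    ∃ b : Module.Basis (Fin (Module.finrank F V)) F V,
      (∀ i j, i ≠ j → QuadraticMap.polar f (b i) (b j) = 0) ∧ ∀ i, f (b i) ≠ 0 := by
  have hB : (QuadraticMap.associated f).Nondegenerate :=
    QuadraticMap.nondegenerate_associated_iff.2 hf
  obtain ⟨b, hb⟩ := LinearMap.BilinForm.exists_orthogonal_basis (K := F) (V := V)
    (B := QuadraticMap.associated f) (QuadraticForm.associated_isSymm F f)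
  have hpolar : ∀ i j, i ≠ j → QuadraticMap.polar f (b i) (b j) = 0 := fun i j hij => by
    rw [← QuadraticMap.polarBilin_apply_apply, ← QuadraticMap.two_nsmul_associated F,
      LinearMap.smul_apply, LinearMap.smul_apply]
    exact (congrArg (2 • ·) (hb hij)).trans (smul_zero 2)
  refine ⟨b, hpolar, fun i hi => ?_⟩
  refine hb.not_isOrtho_basis_self_of_separatingLeft hB.1 i ?_
  exact (QuadraticMap.associated_eq_self_apply F f (b i)).trans hi

/-- A global orthogonal basis of anisotropic vectors keeps these properties after base change, so
`exists_isSpinorNorm` applies at every place. -/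
theorem exists_isSpinorNorm_local [FiniteDimensional F V] {f : QuadraticForm F V}
    (hf : f.Nondegenerate) {σ : LocalSpace F V 𝔭 ≃ₗ[𝔭.adicCompletion F] LocalSpace F V 𝔭}
    (hσ : σ ∈ specialOrthogonal (localForm f 𝔭)) : ∃ a, IsSpinorNorm (localForm f 𝔭) σ a := by
  obtain ⟨b, hb, hb'⟩ := exists_orthogonal_basis hf
  have : Invertible (2 : 𝔭.adicCompletion F) :=
    (Invertible.map (algebraMap F (𝔭.adicCompletion F)) 2).copy 2 (map_ofNat _ _).symm
  refine exists_isSpinorNorm (b.baseChange (𝔭.adicCompletion F)) (fun i j hij => ?_) (fun i => ?_)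
    hσ.1
  · rw [Module.Basis.baseChange_apply, Module.Basis.baseChange_apply, polar_localForm_one_tmul,
      hb i j hij, map_zero]
  · rw [Module.Basis.baseChange_apply, localForm_one_tmul]
    simpa using hb' i

end QuadraticSpaces

/-! ### Clifford algebras at the places, and integrality of conjugation. -/

section Clifford

variable {R : Type*} [CommRing R] [IsDedekindDomain R]
  {F : Type*} [Field F] [Algebra R F] [IsFractionRing R F] [Invertible (2 : F)]
  {V : Type*} [AddCommGroup V] [Module F V] (f : QuadraticForm F V) (𝔭 : HeightOneSpectrum R)

open CliffordAlgebra

/-- When `2` is invertible the Clifford algebra is linearly the exterior algebra, compatibly with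
`ι`. Injectivity supplies the linear retraction `P` of `C(V)` onto `V` used below to read off
vectors. -/
theorem ι_injective_of_invertible_two : Function.Injective (ι f) := by
  intro x y h
  have hι : ∀ z, equivExterior f (ι f z) = ExteriorAlgebra.ι F z :=
    fun z => changeForm_ι changeForm.associated_neg_proof z
  have := congrArg (equivExterior f) h
  rw [hι, hι] at this
  exact ExteriorAlgebra.ι_leftInverse.injective this

theorem cliffordLocal_ι (x : V) :
    cliffordLocal f 𝔭 (ι f x) = ι (localForm f 𝔭) (1 ⊗ₜ[F] x) :=
  ofBaseChange_tmul_ι (𝔭.adicCompletion F) f 1 x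

theorem cliffordLocal_eq (x : CliffordAlgebra f) :
    cliffordLocal f 𝔭 x = ofBaseChangeAux (𝔭.adicCompletion F) f x := by
  change algebraMap (𝔭.adicCompletion F) _ 1 * ofBaseChangeAux (𝔭.adicCompletion F) f x = _
  rw [map_one, one_mul]

theorem cliffordLocal_mul (x y : CliffordAlgebra f) :
    cliffordLocal f 𝔭 (x * y) = cliffordLocal f 𝔭 x * cliffordLocal f 𝔭 y := by
  simp only [cliffordLocal_eq, map_mul]

theorem cliffordLocal_one : cliffordLocal f 𝔭 (1 : CliffordAlgebra f) = 1 := by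
  rw [cliffordLocal_eq, map_one]

theorem cliffordLocal_star (x : CliffordAlgebra f) :
    cliffordLocal f 𝔭 (star x) = star (cliffordLocal f 𝔭 x) := by
  simp only [cliffordLocal_eq]
  induction x using CliffordAlgebra.induction with
  | algebraMap r =>
    rw [star_algebraMap, AlgHom.commutes,
      IsScalarTower.algebraMap_apply F (𝔭.adicCompletion F) (CliffordAlgebra (localForm f 𝔭)),
      star_algebraMap]
  | ι x => rw [star_ι, map_neg, ofBaseChangeAux_ι, star_ι]
  | mul x y hx hy => rw [star_mul, map_mul, map_mul, star_mul, hx, hy]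
  | add x y hx hy => rw [star_add, map_add, map_add, star_add, hx, hy]

/-- The linear extension to `C(V_𝔭)` of a linear map `C(V) → V`. -/
noncomputable def cliffordProjection (P : CliffordAlgebra f →ₗ[F] V) :
    CliffordAlgebra (localForm f 𝔭) →ₗ[𝔭.adicCompletion F] LocalSpace F V 𝔭 :=
  P.baseChange (𝔭.adicCompletion F) ∘ₗ (toBaseChange (𝔭.adicCompletion F) f).toLinearMap

theorem cliffordProjection_cliffordLocal (P : CliffordAlgebra f →ₗ[F] V) (x : CliffordAlgebra f) :
    cliffordProjection f 𝔭 P (cliffordLocal f 𝔭 x) = 1 ⊗ₜ[F] P x := by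
  change P.baseChange (𝔭.adicCompletion F) (toBaseChange (𝔭.adicCompletion F) f
    (ofBaseChange (𝔭.adicCompletion F) f (1 ⊗ₜ[F] x))) = _
  rw [toBaseChange_ofBaseChange, LinearMap.baseChange_tmul]

theorem cliffordProjection_ι {P : CliffordAlgebra f →ₗ[F] V} (hP : P ∘ₗ ι f = LinearMap.id)
    (w : LocalSpace F V 𝔭) : cliffordProjection f 𝔭 P (ι (localForm f 𝔭) w) = w := by
  have h : cliffordProjection f 𝔭 P ∘ₗ ι (localForm f 𝔭) = LinearMap.id := by
    refine TensorProduct.AlgebraTensorModule.curry_injective ?_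
    ext x
    change cliffordProjection f 𝔭 P (ι (localForm f 𝔭) (1 ⊗ₜ[F] x)) = 1 ⊗ₜ[F] x
    rw [← cliffordLocal_ι, cliffordProjection_cliffordLocal]
    exact congrArg _ (LinearMap.congr_fun hP x)
  exact LinearMap.congr_fun h w

/-- The conjugation `star` as a linear map. -/
def starLinear {E W : Type*} [CommRing E] [AddCommGroup W] [Module E W] (q : QuadraticForm E W) :
    CliffordAlgebra q →ₗ[E] CliffordAlgebra q where
  toFun := star
  map_add' := star_add
  map_smul' := CliffordAlgebra.star_smul

variable [Module R V] [IsScalarTower R F V]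

/-- Integrality of a linear map on a local Clifford lattice can be tested on global generators;
`localLattice_apply_mem` is the analogue for vectors. -/
theorem localClifford_apply_mem {W : Type*} [AddCommGroup W] [Module (𝔭.adicCompletion F) W]
    (φ : CliffordAlgebra (localForm f 𝔭) →ₗ[𝔭.adicCompletion F] W)
    (N : Submodule (𝔭.adicCompletionIntegers F) W) {s : Set (CliffordAlgebra f)}
    (h : ∀ x ∈ s, φ (cliffordLocal f 𝔭 x) ∈ N) {x : CliffordAlgebra (localForm f 𝔭)}
    (hx : x ∈ localCliffordLattice f (Submodule.span R s) 𝔭) : φ x ∈ N := by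
  induction hx using Submodule.span_induction with
  | mem x hx =>
    obtain ⟨y, hy, rfl⟩ := hx
    rw [SetLike.mem_coe] at hy
    induction hy using Submodule.span_induction with
    | mem y hy => exact h y hy
    | zero => rw [cliffordLocal_eq, map_zero, map_zero]; exact zero_mem _
    | add y z _ _ hy hz =>
      rw [cliffordLocal_eq, map_add, ← cliffordLocal_eq, ← cliffordLocal_eq, map_add]
      exact add_mem hy hz
    | smul r y _ hy =>
      have : cliffordLocal f 𝔭 (r • y) =
          algebraMap R (𝔭.adicCompletion F) r • cliffordLocal f 𝔭 y := by
        rw [cliffordLocal_eq, cliffordLocal_eq, ← algebraMap_smul F r y, map_smul,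
          IsScalarTower.algebraMap_apply R F (𝔭.adicCompletion F)]
        exact (algebraMap_smul (𝔭.adicCompletion F) (algebraMap R F r) _).symm
      rw [this, map_smul]
      exact algebraMap_smul_mem N r hy
  | zero => rw [map_zero]; exact zero_mem _
  | add x y _ _ hx hy => rw [map_add]; exact add_mem hx hy
  | smul c x _ hx =>
    change φ ((c : 𝔭.adicCompletion F) • x) ∈ N
    rw [map_smul]
    exact N.smul_mem c hx

omit [Invertible (2 : F)] in
theorem localLattice_apply_mem {W : Type*} [AddCommGroup W] [Module (𝔭.adicCompletion F) W]
    (φ : LocalSpace F V 𝔭 →ₗ[𝔭.adicCompletion F] W)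
    (N : Submodule (𝔭.adicCompletionIntegers F) W) {s : Set V}
    (h : ∀ x ∈ s, φ (1 ⊗ₜ[F] x) ∈ N) {x : LocalSpace F V 𝔭}
    (hx : x ∈ localLattice (Submodule.span R s) 𝔭) : φ x ∈ N := by
  induction hx using Submodule.span_induction with
  | mem x hx =>
    obtain ⟨y, hy, rfl⟩ := hx
    rw [SetLike.mem_coe] at hy
    beta_reduce
    induction hy using Submodule.span_induction with
    | mem y hy => exact h y hy
    | zero => rw [TensorProduct.tmul_zero, map_zero]; exact zero_mem _
    | add y z _ _ hy hz => rw [TensorProduct.tmul_add, map_add]; exact add_mem hy hz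
    | smul r y _ hy =>
      rw [← algebraMap_smul_one_tmul, map_smul]
      exact algebraMap_smul_mem N r hy
  | zero => rw [map_zero]; exact zero_mem _
  | add x y _ _ hx hy => rw [map_add]; exact add_mem hx hy
  | smul c x _ hx =>
    change φ ((c : 𝔭.adicCompletion F) • x) ∈ N
    rw [map_smul]
    exact N.smul_mem c hx

/-- At almost all places, conjugation by integral elements of the Clifford algebra preserves the
integrality of vectors. -/
theorem exists_conj_mem_localLattice {Λ : Submodule R (CliffordAlgebra f)} (hΛ : Λ.FG)
    {K : Submodule R V} (hK : Submodule.IsLattice F K) (P : CliffordAlgebra f →ₗ[F] V) :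
    ∃ d : R, d ≠ 0 ∧ ∀ 𝔭 : HeightOneSpectrum R, d ∉ 𝔭.asIdeal →
      ∀ x ∈ localCliffordLattice f Λ 𝔭, ∀ k ∈ localLattice K 𝔭,
        cliffordProjection f 𝔭 P (x * ι (localForm f 𝔭) k * star x) ∈ localLattice K 𝔭 ∧
        cliffordProjection f 𝔭 P (star x * ι (localForm f 𝔭) k * x) ∈ localLattice K 𝔭 := by
  classical
  obtain ⟨s, rfl⟩ := hΛ
  obtain ⟨t, ht⟩ := hK.fg
  obtain ⟨d, hd, h1⟩ := exists_smul_mem_of_finite (s ×ˢ t ×ˢ s) hK.span_eq_top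
    (fun a => P (a.1 * ι f a.2.1 * star a.2.2))
  obtain ⟨e, he, h2⟩ := exists_smul_mem_of_finite (s ×ˢ t ×ˢ s) hK.span_eq_top
    (fun a => P (star a.1 * ι f a.2.1 * a.2.2))
  refine ⟨d * e, mul_ne_zero hd he, fun 𝔭 hp => ?_⟩
  have hdiv : ∀ c : R, c ∉ 𝔭.asIdeal → ∀ v : V, c • v ∈ K →
      (1 : 𝔭.adicCompletion F) ⊗ₜ[F] v ∈ localLattice K 𝔭 := by
    intro c hc v hv
    refine mem_of_algebraMap_smul_mem _ hc ?_
    rw [algebraMap_smul_one_tmul]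
    exact one_tmul_mem_localLattice 𝔭 hv
  have hd' : d ∉ 𝔭.asIdeal := fun h => hp (𝔭.asIdeal.mul_mem_right e h)
  have he' : e ∉ 𝔭.asIdeal := fun h => hp (𝔭.asIdeal.mul_mem_left d h)
  let C := CliffordAlgebra (localForm f 𝔭)
  let E := 𝔭.adicCompletion F
  let ψ := cliffordProjection f 𝔭 P
  -- Conjugation is quadratic in `x`. Replacing its second occurrence by an independent `y` makes
  -- the expression additive in each variable, so it can be checked on generators.
  have hx : ∀ x ∈ localCliffordLattice f (Submodule.span R s) 𝔭, ∀ k ∈ localLattice K 𝔭,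
      ∀ y ∈ localCliffordLattice f (Submodule.span R s) 𝔭,
      ψ (x * ι (localForm f 𝔭) k * star y) ∈ localLattice K 𝔭 ∧
      ψ (star x * ι (localForm f 𝔭) k * y) ∈ localLattice K 𝔭 := by
    intro x hx k hk y hy
    rw [← ht] at hk
    constructor
    · refine localClifford_apply_mem f 𝔭
        (ψ ∘ₗ LinearMap.mulRight E (star y) ∘ₗ LinearMap.mulRight E (ι (localForm f 𝔭) k)) _
        (fun a ha => ?_) hx
      refine localLattice_apply_mem 𝔭 (ψ ∘ₗ LinearMap.mulRight E (star y) ∘ₗ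
        LinearMap.mulLeft E (cliffordLocal f 𝔭 a) ∘ₗ ι (localForm f 𝔭)) _ (fun b hb => ?_) hk
      refine localClifford_apply_mem f 𝔭 (ψ ∘ₗ LinearMap.mulLeft E (cliffordLocal f 𝔭 a *
        ι (localForm f 𝔭) (1 ⊗ₜ[F] b)) ∘ₗ starLinear (localForm f 𝔭)) _ (fun c hc => ?_) hy
      change ψ (cliffordLocal f 𝔭 a * ι (localForm f 𝔭) (1 ⊗ₜ[F] b) *
        star (cliffordLocal f 𝔭 c)) ∈ _
      rw [← cliffordLocal_ι, ← cliffordLocal_star, ← cliffordLocal_mul, ← cliffordLocal_mul]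
      change cliffordProjection f 𝔭 P _ ∈ _
      rw [cliffordProjection_cliffordLocal]
      exact hdiv d hd' _ (h1 (a, b, c) (by simpa using ⟨ha, hb, hc⟩))
    · refine localClifford_apply_mem f 𝔭
        (ψ ∘ₗ LinearMap.mulRight E y ∘ₗ LinearMap.mulRight E (ι (localForm f 𝔭) k) ∘ₗ
          starLinear (localForm f 𝔭)) _ (fun a ha => ?_) hx
      refine localLattice_apply_mem 𝔭 (ψ ∘ₗ LinearMap.mulRight E y ∘ₗ
        LinearMap.mulLeft E (star (cliffordLocal f 𝔭 a)) ∘ₗ ι (localForm f 𝔭)) _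
        (fun b hb => ?_) hk
      refine localClifford_apply_mem f 𝔭 (ψ ∘ₗ LinearMap.mulLeft E (star (cliffordLocal f 𝔭 a) *
        ι (localForm f 𝔭) (1 ⊗ₜ[F] b))) _ (fun c hc => ?_) hy
      change ψ (star (cliffordLocal f 𝔭 a) * ι (localForm f 𝔭) (1 ⊗ₜ[F] b) *
        cliffordLocal f 𝔭 c) ∈ _
      rw [← cliffordLocal_ι, ← cliffordLocal_star, ← cliffordLocal_mul, ← cliffordLocal_mul]
      change cliffordProjection f 𝔭 P _ ∈ _
      rw [cliffordProjection_cliffordLocal]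
      exact hdiv e he' _ (h2 (a, b, c) (by simpa using ⟨ha, hb, hc⟩))
  exact fun x hx' k hk => hx x hx' k hk x hx'

variable {f 𝔭}

/-- `g ∈ C(V_𝔭)` acts on `V_𝔭` by conjugation as `σ`. -/
def ConjActsAs (g : CliffordAlgebra (localForm f 𝔭))
    (σ : LocalSpace F V 𝔭 ≃ₗ[𝔭.adicCompletion F] LocalSpace F V 𝔭) : Prop :=
  star g * g = 1 ∧ ∀ w, g * ι (localForm f 𝔭) w * star g = ι (localForm f 𝔭) (σ w)

omit [Module R V] [IsScalarTower R F V] in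
theorem ConjActsAs.star_mul_ι_mul {g : CliffordAlgebra (localForm f 𝔭)}
    {σ : LocalSpace F V 𝔭 ≃ₗ[𝔭.adicCompletion F] LocalSpace F V 𝔭} (h : ConjActsAs g σ)
    (w : LocalSpace F V 𝔭) :
    star g * ι (localForm f 𝔭) (σ w) * g = ι (localForm f 𝔭) w := by
  rw [← h.2, mul_assoc g, ← mul_assoc (star g) g, h.1, one_mul, mul_assoc, h.1, mul_one]

omit [Module R V] [IsScalarTower R F V] in
/-- Integrality of conjugation in both directions gives equality of local lattices. -/
theorem ConjActsAs.mapLocal_eq {g : CliffordAlgebra (localForm f 𝔭)}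
    {σ : LocalSpace F V 𝔭 ≃ₗ[𝔭.adicCompletion F] LocalSpace F V 𝔭} (h : ConjActsAs g σ)
    {P : CliffordAlgebra f →ₗ[F] V} (hP : P ∘ₗ ι f = LinearMap.id)
    {M N : Submodule (𝔭.adicCompletionIntegers F) (LocalSpace F V 𝔭)}
    (hM : ∀ m ∈ M, cliffordProjection f 𝔭 P (g * ι (localForm f 𝔭) m * star g) ∈ N)
    (hN : ∀ n ∈ N, cliffordProjection f 𝔭 P (star g * ι (localForm f 𝔭) n * g) ∈ M) :
    mapLocal σ M = N := by
  refine le_antisymm ?_ fun n hn => ?_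
  · rintro _ ⟨m, hm, rfl⟩
    have := hM m hm
    rwa [h.2, cliffordProjection_ι f 𝔭 hP] at this
  · refine ⟨σ.symm n, ?_, σ.apply_symm_apply n⟩
    have h1 := h.star_mul_ι_mul (σ.symm n)
    rw [σ.apply_symm_apply] at h1
    have := hN n hn
    rwa [h1, cliffordProjection_ι f 𝔭 hP] at this

-- Both sides of the conjugation identity are linear over the completion, so it is enough to compare
-- them on the vectors of `V`.
omit [Module R V] [IsScalarTower R F V] in
theorem conjActsAs_cliffordLocal {g : CliffordAlgebra f} (hg : g ∈ spinGroup f) {τ : V ≃ₗ[F] V}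
    (h : ∀ v, g * ι f v * star g = ι f (τ v)) (𝔭 : HeightOneSpectrum R) :
    ConjActsAs (cliffordLocal f 𝔭 g) (localize 𝔭 τ) := by
  constructor
  · rw [← cliffordLocal_star, ← cliffordLocal_mul, spinGroup.star_mul_self_of_mem hg,
      cliffordLocal_one]
  · have key : LinearMap.mulRight (𝔭.adicCompletion F) (star (cliffordLocal f 𝔭 g)) ∘ₗ
        LinearMap.mulLeft (𝔭.adicCompletion F) (cliffordLocal f 𝔭 g) ∘ₗ ι (localForm f 𝔭) =
        ι (localForm f 𝔭) ∘ₗ (localize 𝔭 τ).toLinearMap := by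
      refine TensorProduct.AlgebraTensorModule.curry_injective ?_
      ext x
      change cliffordLocal f 𝔭 g * ι (localForm f 𝔭) (1 ⊗ₜ[F] x) * star (cliffordLocal f 𝔭 g) =
        ι (localForm f 𝔭) (1 ⊗ₜ[F] τ x)
      rw [← cliffordLocal_ι, ← cliffordLocal_star, ← cliffordLocal_mul, ← cliffordLocal_mul, h,
        cliffordLocal_ι]
    exact fun w => LinearMap.congr_fun key w

end Clifford

/-! ### From spinor norm one to a global rotation. -/

section StrongApproximation

variable {R : Type*} [CommRing R] [IsDedekindDomain R]
  {F : Type*} [Field F] [Algebra R F] [IsFractionRing R F]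
  {V : Type*} [AddCommGroup V] [Module F V] [Module R V] [IsScalarTower R F V]
  [FiniteDimensional F V]

open CliffordAlgebra

/-- A local lattice is open. -/
theorem isOpen_localLattice {K : Submodule R V} (hK : Submodule.IsLattice F K)
    (𝔭 : HeightOneSpectrum R) [TopologicalSpace (LocalSpace F V 𝔭)]
    [IsModuleTopology (𝔭.adicCompletion F) (LocalSpace F V 𝔭)] :
    IsOpen (localLattice (F := F) K 𝔭 : Set (LocalSpace F V 𝔭)) := by
  have := IsModuleTopology.topologicalAddGroup (𝔭.adicCompletion F) (LocalSpace F V 𝔭)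
  let b := Module.finBasis F V
  let B := b.baseChange (𝔭.adicCompletion F)
  obtain ⟨d, hd, hdb⟩ := exists_smul_mem_of_finite Finset.univ hK.span_eq_top b
  have hd0 : algebraMap R (𝔭.adicCompletion F) d ≠ 0 := by
    rw [← Valuation.ne_zero_iff Valued.v, valued_algebraMap_of_base]
    exact 𝔭.intValuation_ne_zero d hd
  -- The box of vectors with coordinates in `d` times the integers is an open neighbourhood of `0`
  -- inside the lattice, and a subgroup containing such a neighbourhood is open.
  let U : Set (LocalSpace F V 𝔭) := ⋂ i,
    (fun w => (algebraMap R (𝔭.adicCompletion F) d)⁻¹ * B.coord i w) ⁻¹'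
      (Valued.v.integer : Subring (𝔭.adicCompletion F))
  have hU : IsOpen U := by
    refine isOpen_iInter_of_finite fun i => (Valued.isOpen_integer _).preimage ?_
    exact continuous_const.mul (IsModuleTopology.continuous_of_linearMap (B.coord i))
  have hUK : U ⊆ localLattice (F := F) K 𝔭 := by
    intro w hw
    rw [SetLike.mem_coe, ← B.sum_repr w]
    refine sum_mem fun i _ => ?_
    have h1 := smul_mem_of_valued_le_one (localLattice K 𝔭) (Set.mem_iInter.1 hw i)
      (one_tmul_mem_localLattice 𝔭 (hdb i (Finset.mem_univ i)))
    rwa [← algebraMap_smul_one_tmul, smul_smul, mul_assoc, mul_comm, mul_assoc,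
      mul_inv_cancel₀ hd0, mul_one, ← Module.Basis.baseChange_apply] at h1
  have h0 : (0 : LocalSpace F V 𝔭) ∈ U := Set.mem_iInter.2 fun i => by
    simp only [Set.mem_preimage, map_zero, mul_zero]
    exact zero_mem _
  exact AddSubgroup.isOpen_of_mem_nhds (localLattice K 𝔭).toAddSubgroup (g := 0)
    (Filter.mem_of_superset (hU.mem_nhds h0) hUK)

variable [Invertible (2 : F)] {f : QuadraticForm F V}

/-- The spin transformations carrying one local lattice to another form an open set. -/
theorem isOpenSpin_conj {K : Submodule R V} (hK : Submodule.IsLattice F K)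
    (𝔭 : HeightOneSpectrum R) [Module.Finite F (CliffordAlgebra f)] (P : CliffordAlgebra f →ₗ[F] V)
    (σ : LocalSpace F V 𝔭 ≃ₗ[𝔭.adicCompletion F] LocalSpace F V 𝔭) (s : Finset V) :
    IsOpenSpin (localForm f 𝔭) {g | ∀ x ∈ s,
      cliffordProjection f 𝔭 P (g * ι (localForm f 𝔭) (1 ⊗ₜ[F] x) * star g.1) ∈
        mapLocal σ (localLattice K 𝔭) ∧
      cliffordProjection f 𝔭 P (star g.1 * ι (localForm f 𝔭) (σ (1 ⊗ₜ[F] x)) * g) ∈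
        localLattice K 𝔭} := by
  let : TopologicalSpace (CliffordAlgebra (localForm f 𝔭)) :=
    moduleTopology (𝔭.adicCompletion F) _
  have : IsModuleTopology (𝔭.adicCompletion F) (CliffordAlgebra (localForm f 𝔭)) := ⟨rfl⟩
  let : TopologicalSpace (LocalSpace F V 𝔭) := moduleTopology (𝔭.adicCompletion F) _
  have : IsModuleTopology (𝔭.adicCompletion F) (LocalSpace F V 𝔭) := ⟨rfl⟩
  -- Finiteness makes multiplication continuous for the module topology; `star` and the projection
  -- are continuous because they are linear.
  have : Module.Finite (𝔭.adicCompletion F) (CliffordAlgebra (localForm f 𝔭)) :=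
    Module.Finite.of_surjective (ofBaseChange (𝔭.adicCompletion F) f).toLinearMap
      fun x => ⟨_, ofBaseChange_toBaseChange (𝔭.adicCompletion F) f x⟩
  have hmul := IsModuleTopology.continuous_mul_of_finite (𝔭.adicCompletion F)
    (CliffordAlgebra (localForm f 𝔭))
  have := IsModuleTopology.topologicalAddGroup (𝔭.adicCompletion F) (LocalSpace F V 𝔭)
  have := IsModuleTopology.topologicalAddGroup (𝔭.adicCompletion F)
    (CliffordAlgebra (localForm f 𝔭))
  have : ContinuousMul (CliffordAlgebra (localForm f 𝔭)) := ⟨hmul⟩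
  have hstar : Continuous (star : CliffordAlgebra (localForm f 𝔭) → _) :=
    IsModuleTopology.continuous_of_linearMap (starLinear (localForm f 𝔭))
  have hproj : Continuous (cliffordProjection f 𝔭 P) := IsModuleTopology.continuous_of_linearMap _
  have hKopen := isOpen_localLattice hK 𝔭
  have hσopen : IsOpen (mapLocal σ (localLattice (F := F) K 𝔭) : Set (LocalSpace F V 𝔭)) := by
    have h : (mapLocal σ (localLattice (F := F) K 𝔭) : Set (LocalSpace F V 𝔭)) =
        σ.symm ⁻¹' (localLattice (F := F) K 𝔭 : Set (LocalSpace F V 𝔭)) := by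
      ext w
      exact ⟨by rintro ⟨m, hm, rfl⟩; simpa using hm, fun h => ⟨_, h, σ.apply_symm_apply w⟩⟩
    rw [h]
    exact hKopen.preimage (IsModuleTopology.continuous_of_linearMap σ.symm.toLinearMap)
  have hset : IsOpen (⋂ x ∈ s, {g : CliffordAlgebra (localForm f 𝔭) |
      cliffordProjection f 𝔭 P (g * ι (localForm f 𝔭) (1 ⊗ₜ[F] x) * star g) ∈
        mapLocal σ (localLattice K 𝔭) ∧
      cliffordProjection f 𝔭 P (star g * ι (localForm f 𝔭) (σ (1 ⊗ₜ[F] x)) * g) ∈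
        localLattice K 𝔭}) := by
    refine isOpen_biInter_finset fun x _ => IsOpen.and ?_ ?_
    · exact hσopen.preimage
        (hproj.comp ((continuous_id.mul continuous_const).mul hstar))
    · exact hKopen.preimage
        (hproj.comp ((hstar.mul continuous_const).mul continuous_id))
  rw [IsOpenSpin, isOpen_induced_iff]
  refine ⟨_, hset, ?_⟩
  ext g
  simp

/-- By strong approximation for the spin group, an adelic family of rotations of spinor norm `1`
acts on lattices like a global rotation. -/
theorem SpinStrongApproximation.exists_mapGlobal (hSA : SpinStrongApproximation R f)
    {K : Submodule R V} (hK : Submodule.IsLattice F K)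
    {σ : ∀ 𝔭 : HeightOneSpectrum R,
      LocalSpace F V 𝔭 ≃ₗ[𝔭.adicCompletion F] LocalSpace F V 𝔭}
    (hσ : σ ∈ adelicSpecialOrthogonal f K) (hσ1 : ∀ 𝔭, IsSpinorNorm (localForm f 𝔭) (σ 𝔭) 1) :
    ∃ τ ∈ specialOrthogonal f,
      ∀ 𝔭, localLattice (F := F) (mapGlobal τ K) 𝔭 = mapLocal (σ 𝔭) (localLattice K 𝔭) := by
  classical
  obtain ⟨Λ, hΛ, S₀, hS₀⟩ := hSA
  -- Generators of the lattice `Λ` span `C(V)` over `F`.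
  have : Module.Finite F (CliffordAlgebra f) := by
    obtain ⟨s, hs⟩ := hΛ.fg
    refine ⟨s, ?_⟩
    rw [eq_top_iff, ← hΛ.span_eq_top, Submodule.span_le, ← hs]
    exact Submodule.span_le_restrictScalars R F (s : Set (CliffordAlgebra f))
  obtain ⟨P, hP⟩ := LinearMap.exists_leftInverse_of_injective (ι f)
    (LinearMap.ker_eq_bot.2 (ι_injective_of_invertible_two f))
  obtain ⟨d, hd, hdΛ⟩ := exists_conj_mem_localLattice f hΛ.fg hK P
  obtain ⟨t, ht⟩ := hK.fg
  -- Outside `S`, the family `σ` fixes `K_𝔭` and conjugation by elements of `Λ_𝔭` preserves the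
  -- integrality of vectors.
  let S : Finset (HeightOneSpectrum R) := S₀ ∪ (hσ.2.toFinset ∪ (finite_setOf_mem hd).toFinset)
  -- Conditions on finitely many generators, in both directions, saying that conjugation carries
  -- `K_𝔭` onto `σ K_𝔭`. A lift of `σ 𝔭` to the spin group satisfies them.
  let U : ∀ 𝔭 : HeightOneSpectrum R, Set (spinGroup (localForm f 𝔭)) := fun 𝔭 =>
    {g | ∀ x ∈ t,
      cliffordProjection f 𝔭 P (g * ι (localForm f 𝔭) (1 ⊗ₜ[F] x) * star g.1) ∈
        mapLocal (σ 𝔭) (localLattice K 𝔭) ∧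
      cliffordProjection f 𝔭 P (star g.1 * ι (localForm f 𝔭) (σ 𝔭 (1 ⊗ₜ[F] x)) * g) ∈
        localLattice K 𝔭}
  have htK : ∀ 𝔭 : HeightOneSpectrum R, ∀ x ∈ t,
      (1 : 𝔭.adicCompletion F) ⊗ₜ[F] x ∈ localLattice K 𝔭 := fun 𝔭 x hx =>
    one_tmul_mem_localLattice 𝔭 (ht ▸ Submodule.subset_span hx)
  have hU : ∀ 𝔭 ∈ S, IsOpenSpin (localForm f 𝔭) (U 𝔭) ∧ (U 𝔭).Nonempty := by
    refine fun 𝔭 _ => ⟨isOpenSpin_conj hK 𝔭 P (σ 𝔭) t, ?_⟩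
    have : Invertible (2 : 𝔭.adicCompletion F) :=
      (Invertible.map (algebraMap F (𝔭.adicCompletion F)) 2).copy 2 (map_ofNat _ _).symm
    obtain ⟨g, hg, hgσ⟩ := exists_spinGroup_of_isSpinorNorm_one (localForm f 𝔭) (hσ.1 𝔭) (hσ1 𝔭)
    have hact : ConjActsAs g (σ 𝔭) := ⟨spinGroup.star_mul_self_of_mem hg, hgσ⟩
    refine ⟨⟨g, hg⟩, fun x hx => ⟨?_, ?_⟩⟩
    · change cliffordProjection f 𝔭 P (g * _ * star g) ∈ _
      rw [hact.2, cliffordProjection_ι f 𝔭 hP]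
      exact ⟨_, htK 𝔭 x hx, rfl⟩
    · change cliffordProjection f 𝔭 P (star g * _ * g) ∈ _
      rw [hact.star_mul_ι_mul, cliffordProjection_ι f 𝔭 hP]
      exact htK 𝔭 x hx
  obtain ⟨g, hg, hgS, hgS'⟩ := hS₀ S Finset.subset_union_left U hU
  obtain ⟨τ, hτ, hτg⟩ := exists_specialOrthogonal_of_mem_spinGroup f hg
  refine ⟨τ, hτ, fun 𝔭 => ?_⟩
  rw [localLattice_mapGlobal]
  have hact := conjActsAs_cliffordLocal hg hτg 𝔭
  set γ := cliffordLocal f 𝔭 g with hγ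
  by_cases h𝔭 : 𝔭 ∈ S
  · obtain ⟨x, hx, hxg⟩ := hgS 𝔭 h𝔭
    refine hact.mapLocal_eq hP (fun m hm => ?_) (fun n hn => ?_)
    · rw [← ht] at hm
      refine localLattice_apply_mem 𝔭 (cliffordProjection f 𝔭 P ∘ₗ
        LinearMap.mulRight (𝔭.adicCompletion F) (star γ) ∘ₗ
        LinearMap.mulLeft (𝔭.adicCompletion F) γ ∘ₗ ι (localForm f 𝔭)) _ (fun y hy => ?_) hm
      have := (hx y hy).1
      rwa [hxg] at this
    · obtain ⟨m, hm, rfl⟩ := hn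
      rw [← ht] at hm
      refine localLattice_apply_mem 𝔭 (cliffordProjection f 𝔭 P ∘ₗ
        LinearMap.mulRight (𝔭.adicCompletion F) γ ∘ₗ
        LinearMap.mulLeft (𝔭.adicCompletion F) (star γ) ∘ₗ ι (localForm f 𝔭) ∘ₗ
        (σ 𝔭).toLinearMap) _ (fun y hy => ?_) hm
      have := (hx y hy).2
      rwa [hxg] at this
  · simp only [S, Finset.mem_union, not_or, Set.Finite.mem_toFinset, Set.mem_ofPred_eq, not_not]
      at h𝔭
    rw [h𝔭.2.1]
    have h := hdΛ 𝔭 h𝔭.2.2 γ (hgS' 𝔭 (by simpa [S] using h𝔭))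
    exact hact.mapLocal_eq hP (fun m hm => (h m hm).1) (fun n hn => (h n hn).2)

end StrongApproximation

/-! ### Quotients of the group of fractional ideals and `Pic(R)/2`. -/

section PicardGroup

open nonZeroDivisors

variable {R : Type*} [CommRing R] [IsDedekindDomain R]
  {F : Type*} [Field F] [Algebra R F] [IsFractionRing R F]

/-- A quotient of the group of fractional ideals that kills principal ideals and squares is a
quotient of `Pic(R)/2`. -/
theorem exists_surjective_picModTwo {Q : Type*} [CommGroup Q] (φ : (FractionalIdeal R⁰ F)ˣ →* Q)
    (hφ : Function.Surjective φ) (hprin : ∀ x : Fˣ, φ (toPrincipalIdeal R F x) = 1)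
    (hsq : ∀ I, φ (I * I) = 1) :
    ∃ ψ : PicModTwo R →+ Additive Q, Function.Surjective ψ := by
  let θ : (FractionalIdeal R⁰ F)ˣ ⧸ (toPrincipalIdeal R F).range →* Q :=
    QuotientGroup.lift _ φ (by rintro _ ⟨x, rfl⟩; exact hprin x)
  let χ : CommRing.Pic R →* Q :=
    θ.comp (((ClassGroup.equivPic R).symm.trans (ClassGroup.equiv F)).toMonoidHom)
  have hχ : Function.Surjective χ := by
    intro y
    obtain ⟨I, rfl⟩ := hφ y
    obtain ⟨x, hx⟩ := ((ClassGroup.equivPic R).symm.trans (ClassGroup.equiv F)).surjective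
      (QuotientGroup.mk I)
    refine ⟨x, ?_⟩
    change θ (((ClassGroup.equivPic R).symm.trans (ClassGroup.equiv F)) x) = φ I
    rw [hx]
    rfl
  have h2 : ∀ y : Additive Q, 2 • y = 0 := by
    intro y
    obtain ⟨I, hI⟩ := hφ y.toMul
    rw [two_nsmul]
    change Additive.ofMul (y.toMul * y.toMul) = 0
    rw [← hI, ← map_mul, hsq]
    rfl
  -- As `Q` is killed by `2`, the pairing `(x, n) ↦ n • χ x` makes sense on `Pic(R) × ℤ/2` and
  -- factors through the tensor product.
  let _ : Module (ZMod 2) (Additive Q) := AddCommGroup.zmodModule h2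
  let B : Additive (CommRing.Pic R) →ₗ[ℤ] ZMod 2 →ₗ[ℤ] Additive Q :=
    LinearMap.mk₂ ℤ (fun x n => n • MonoidHom.toAdditive χ x)
      (fun x y n => by rw [map_add, smul_add])
      (fun c x n => by rw [map_zsmul, smul_comm])
      (fun x m n => add_smul m n _)
      (fun c x n => smul_assoc c n _)
  refine ⟨(TensorProduct.lift B).toAddMonoidHom, fun y => ?_⟩
  obtain ⟨x, hx⟩ := hχ y.toMul
  refine ⟨Additive.ofMul x ⊗ₜ 1, ?_⟩
  change TensorProduct.lift B (Additive.ofMul x ⊗ₜ 1) = y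
  rw [TensorProduct.lift.tmul]
  change (1 : ZMod 2) • MonoidHom.toAdditive χ (Additive.ofMul x) = y
  rw [one_smul]
  exact congrArg Additive.ofMul hx

/-- By `hmul` the fibres of `Φ` are the classes of a congruence. The range of `Φ` is thus in
bijection with a quotient group, on which `hprin` and `hsq` give a surjection from `Pic(R)/2`; no
group structure on `X` is needed. -/
theorem exists_encard_range_dvd {X : Type*} (Φ : (FractionalIdeal R⁰ F)ˣ → X)
    (hmul : ∀ A I J, Φ I = Φ J → Φ (A * I) = Φ (A * J))
    (hprin : ∀ x : Fˣ, Φ (toPrincipalIdeal R F x) = Φ 1) (hsq : ∀ I, Φ (I * I) = Φ 1)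
    [Finite (PicModTwo R)] :
    ∃ h : ℕ, (Set.range Φ).encard = h ∧ h ∣ Nat.card (PicModTwo R) := by
  let c : Con (FractionalIdeal R⁰ F)ˣ :=
    { r := fun I J => Φ I = Φ J
      iseqv := ⟨fun _ => rfl, Eq.symm, Eq.trans⟩
      mul' := fun {I J A B} h h' => by
        rw [hmul I A B h', mul_comm I, hmul B I J h, mul_comm] }
  have hprin' : ∀ x : Fˣ, c.mk' (toPrincipalIdeal R F x) = 1 := fun x => (Con.eq c).2 (hprin x)
  have hsq' : ∀ I, c.mk' (I * I) = 1 := fun I => (Con.eq c).2 (hsq I)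
  obtain ⟨ψ, hψ⟩ := exists_surjective_picModTwo (R := R) (F := F) (Q := c.Quotient) c.mk' Con.mk'_surjective hprin' hsq'
  have hfin : Finite (Additive c.Quotient) := Finite.of_surjective ψ hψ
  have hfin' : Finite c.Quotient := hfin
  let e : c.Quotient ≃ Set.range Φ := Setoid.quotientKerEquivRange Φ
  have hfin'' : Finite (Set.range Φ) := Finite.of_equiv _ e
  refine ⟨Nat.card (Additive c.Quotient), ?_, AddSubgroup.card_dvd_of_surjective ψ hψ⟩
  have hcard : Nat.card (Additive c.Quotient) = Nat.card (Set.range Φ) := Nat.card_congr e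
  rw [hcard, Set.encard, ENat.card_eq_coe_natCard]

/-- Both sides are multiplicative and agree on nonzero elements of `R`; a fraction is handled by
multiplying out its denominator. -/
theorem valuation_eq_exp_neg_count (𝔭 : HeightOneSpectrum R) (x : Fˣ) :
    𝔭.valuation F (x : F) =
      WithZero.exp (-(FractionalIdeal.count F 𝔭 (toPrincipalIdeal R F x : FractionalIdeal R⁰ F))) := by
  have hR : ∀ r : R, r ≠ 0 → 𝔭.valuation F (algebraMap R F r) =
      WithZero.exp (-(FractionalIdeal.count F 𝔭
        (FractionalIdeal.spanSingleton R⁰ (algebraMap R F r)))) := by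
    intro r hr
    rw [HeightOneSpectrum.valuation_of_algebraMap, HeightOneSpectrum.intValuation_if_neg 𝔭 hr,
      ← FractionalIdeal.coeIdeal_span_singleton, FractionalIdeal.count_coe]
    simpa using hr
  obtain ⟨r, s, hs, hrs⟩ := IsFractionRing.div_surjective (A := R) (x : F)
  have hs0 : s ≠ 0 := nonZeroDivisors.ne_zero hs
  have hs' : algebraMap R F s ≠ 0 := by simpa using hs0
  have hr0 : r ≠ 0 := by
    rintro rfl
    rw [map_zero, zero_div] at hrs
    exact x.ne_zero hrs.symm
  have h1 : (x : F) * algebraMap R F s = algebraMap R F r := by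
    rw [← hrs]; field_simp
  have h2 : FractionalIdeal.count F 𝔭 (FractionalIdeal.spanSingleton R⁰ (x : F)) +
      FractionalIdeal.count F 𝔭 (FractionalIdeal.spanSingleton R⁰ (algebraMap R F s)) =
      FractionalIdeal.count F 𝔭 (FractionalIdeal.spanSingleton R⁰ (algebraMap R F r)) := by
    rw [← FractionalIdeal.count_mul, FractionalIdeal.spanSingleton_mul_spanSingleton, h1]
    · exact FractionalIdeal.spanSingleton_ne_zero_iff.2 x.ne_zero
    · exact FractionalIdeal.spanSingleton_ne_zero_iff.2 hs'
  have h3 := congrArg (𝔭.valuation F) h1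
  rw [map_mul, hR s hs0, hR r hr0, ← h2] at h3
  rw [coe_toPrincipalIdeal]
  have h4 : WithZero.exp (-FractionalIdeal.count F 𝔭
      (FractionalIdeal.spanSingleton R⁰ (algebraMap R F s))) ≠ 0 := WithZero.exp_ne_zero
  apply mul_right_cancel₀ h4
  rw [h3, ← WithZero.exp_add, neg_add]

end PicardGroup

/-! ### Spinor ideals of adelic rotations and proper classes. -/

section ClassesAndIdeals

open nonZeroDivisors

variable {R : Type*} [CommRing R] [IsDedekindDomain R]
  {F : Type*} [Field F] [Algebra R F] [IsFractionRing R F]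
  {V : Type*} [AddCommGroup V] [Module F V] [Module R V] [IsScalarTower R F V]

theorem finite_setOf_localLattice_ne {K L : Submodule R V} (hK : Submodule.IsLattice F K)
    (hL : Submodule.IsLattice F L) :
    {𝔭 : HeightOneSpectrum R | localLattice (F := F) K 𝔭 ≠ localLattice L 𝔭}.Finite := by
  obtain ⟨d, hd, hdK⟩ := exists_smul_le hK.fg hL.span_eq_top
  obtain ⟨e, he, heL⟩ := exists_smul_le hL.fg hK.span_eq_top
  have key : ∀ (K L : Submodule R V) (c : R), (∀ x ∈ K, c • x ∈ L) →
      ∀ 𝔭 : HeightOneSpectrum R, c ∉ 𝔭.asIdeal →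
      localLattice (F := F) K 𝔭 ≤ localLattice L 𝔭 :=
    fun K L c hc 𝔭 hp m hm =>
      mem_of_algebraMap_smul_mem _ hp (algebraMap_smul_mem_localLattice hc hm)
  refine (finite_setOf_mem (mul_ne_zero hd he)).subset fun 𝔭 h𝔭 => ?_
  by_contra hde
  exact h𝔭 (le_antisymm (key K L d hdK 𝔭 fun h => hde (𝔭.asIdeal.mul_mem_right e h))
    (key L K e heL 𝔭 fun h => hde (𝔭.asIdeal.mul_mem_left d h)))

variable [Invertible (2 : F)] {f : QuadraticForm F V}

theorem adelicSpecialOrthogonal_subset {K L : Submodule R V} (hK : Submodule.IsLattice F K)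
    (hL : Submodule.IsLattice F L) :
    adelicSpecialOrthogonal f L ⊆ adelicSpecialOrthogonal f K := by
  refine fun σ hσ => ⟨hσ.1, (hσ.2.union (finite_setOf_localLattice_ne hK hL)).subset ?_⟩
  intro 𝔭 h𝔭
  by_contra h
  simp only [Set.mem_union, Set.mem_ofPred_eq, not_or, not_not] at h
  exact h𝔭 (by rw [h.2, h.1])

theorem mul_mem_adelicSpecialOrthogonal {L : Submodule R V}
    {σ τ : ∀ 𝔭 : HeightOneSpectrum R,
      LocalSpace F V 𝔭 ≃ₗ[𝔭.adicCompletion F] LocalSpace F V 𝔭}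
    (hσ : σ ∈ adelicSpecialOrthogonal f L) (hτ : τ ∈ adelicSpecialOrthogonal f L) :
    σ * τ ∈ adelicSpecialOrthogonal f L := by
  refine ⟨fun 𝔭 => mul_mem (hσ.1 𝔭) (hτ.1 𝔭), (hσ.2.union hτ.2).subset fun 𝔭 h𝔭 => ?_⟩
  by_contra h
  simp only [Set.mem_union, Set.mem_ofPred_eq, not_or, not_not] at h
  exact h𝔭 (by rw [Pi.mul_apply, mapLocal_mul, h.2, h.1])

theorem inv_mem_adelicSpecialOrthogonal {L : Submodule R V}
    {σ : ∀ 𝔭 : HeightOneSpectrum R,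
      LocalSpace F V 𝔭 ≃ₗ[𝔭.adicCompletion F] LocalSpace F V 𝔭}
    (hσ : σ ∈ adelicSpecialOrthogonal f L) : σ⁻¹ ∈ adelicSpecialOrthogonal f L := by
  refine ⟨fun 𝔭 => inv_mem (hσ.1 𝔭), hσ.2.subset fun 𝔭 h𝔭 => ?_⟩
  exact fun h => h𝔭 (mapLocal_inv_eq h)

theorem one_mem_adelicSpecialOrthogonal (L : Submodule R V) :
    1 ∈ adelicSpecialOrthogonal f L := by
  refine ⟨fun 𝔭 => one_mem _, ?_⟩
  convert Set.finite_empty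
  ext 𝔭
  simpa using mapLocal_one _

theorem localize_mem_adelicSpecialOrthogonal [FiniteDimensional F V] {L : Submodule R V}
    (hL : Submodule.IsLattice F L) {τ : V ≃ₗ[F] V} (hτ : τ ∈ specialOrthogonal f) :
    (fun 𝔭 => localize 𝔭 τ) ∈ adelicSpecialOrthogonal f L := by
  refine ⟨fun 𝔭 => localize_mem_specialOrthogonal 𝔭 hτ, ?_⟩
  simp only [← localLattice_mapGlobal]
  exact finite_setOf_localLattice_ne (isLattice_mapGlobal τ hL) hL

omit [Invertible (2 : F)] in
theorem mapGlobal_mul (σ τ : V ≃ₗ[F] V) (K : Submodule R V) :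
    mapGlobal (σ * τ) K = mapGlobal σ (mapGlobal τ K) :=
  Submodule.map_comp (τ.toLinearMap.restrictScalars R) (σ.toLinearMap.restrictScalars R) K

omit [Invertible (2 : F)] in
theorem mapGlobal_one (K : Submodule R V) : mapGlobal (1 : V ≃ₗ[F] V) K = K :=
  Submodule.map_id K

omit [Invertible (2 : F)] in
theorem mem_properClass_self (K : Submodule R V) : K ∈ properClass f K :=
  ⟨1, one_mem _, (mapGlobal_one K).symm⟩

omit [Invertible (2 : F)] in
theorem properClass_eq_of_mem {K K' : Submodule R V} (h : K' ∈ properClass f K) :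
    properClass f K' = properClass f K := by
  obtain ⟨τ, hτ, rfl⟩ := h
  ext N
  constructor
  · rintro ⟨ρ, hρ, rfl⟩
    exact ⟨ρ * τ, mul_mem hρ hτ, (mapGlobal_mul ρ τ K).symm⟩
  · rintro ⟨ρ, hρ, rfl⟩
    exact ⟨ρ * τ⁻¹, mul_mem hρ (inv_mem hτ), by
      rw [← mapGlobal_mul, inv_mul_cancel_right]⟩

variable (f)

/-- The ideal `I` has at each place the valuation of a spinor norm of the family `σ`. -/
def HasSpinorIdeal (σ : ∀ 𝔭 : HeightOneSpectrum R,
      LocalSpace F V 𝔭 ≃ₗ[𝔭.adicCompletion F] LocalSpace F V 𝔭)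
    (I : (FractionalIdeal R⁰ F)ˣ) : Prop :=
  ∀ 𝔭, ∃ a : (𝔭.adicCompletion F)ˣ, IsSpinorNorm (localForm f 𝔭) (σ 𝔭) a ∧
    Valued.v (a : 𝔭.adicCompletion F) = WithZero.exp (-(FractionalIdeal.count F 𝔭 I.1))

/-- `K` is obtained from `L` by an adelic rotation whose spinor norm generates `I`. -/
def IsTransform (L : Submodule R V) (I : (FractionalIdeal R⁰ F)ˣ) (K : Submodule R V) : Prop :=
  Submodule.IsLattice F K ∧ ∃ σ ∈ adelicSpecialOrthogonal f L, HasSpinorIdeal f σ I ∧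
    ∀ 𝔭, localLattice K 𝔭 = mapLocal (σ 𝔭) (localLattice L 𝔭)

variable {f}

omit [Module R V] [IsScalarTower R F V] in
theorem HasSpinorIdeal.mul {σ τ : ∀ 𝔭 : HeightOneSpectrum R,
      LocalSpace F V 𝔭 ≃ₗ[𝔭.adicCompletion F] LocalSpace F V 𝔭}
    {I J : (FractionalIdeal R⁰ F)ˣ} (hσ : HasSpinorIdeal f σ I) (hτ : HasSpinorIdeal f τ J) :
    HasSpinorIdeal f (σ * τ) (I * J) := by
  intro 𝔭
  obtain ⟨a, ha, hav⟩ := hσ 𝔭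
  obtain ⟨b, hb, hbv⟩ := hτ 𝔭
  refine ⟨a * b, ha.mul hb, ?_⟩
  rw [Units.val_mul, map_mul, hav, hbv, ← WithZero.exp_add, Units.val_mul,
    FractionalIdeal.count_mul F 𝔭 I.ne_zero J.ne_zero, neg_add]

-- Spinor norms are defined up to squares, so the identity has a spinor norm of any even valuation.
omit [Module R V] [IsScalarTower R F V] in
theorem hasSpinorIdeal_one_mul_self (I : (FractionalIdeal R⁰ F)ˣ) :
    HasSpinorIdeal f 1 (I * I) := by
  intro 𝔭
  obtain ⟨x, hx⟩ := HeightOneSpectrum.valuation_surjective F 𝔭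
    (WithZero.exp (-(FractionalIdeal.count F 𝔭 I.1)))
  have hx0 : x ≠ 0 := by
    rintro rfl
    rw [map_zero] at hx
    exact WithZero.exp_ne_zero hx.symm
  let c : (𝔭.adicCompletion F)ˣ :=
    Units.map (algebraMap F (𝔭.adicCompletion F)).toMonoidHom (Units.mk0 x hx0)
  have hc : Valued.v (c : 𝔭.adicCompletion F) =
      WithZero.exp (-(FractionalIdeal.count F 𝔭 I.1)) := by
    rw [← hx, ← valued_algebraMap]
    rfl
  refine ⟨1 * c ^ 2, IsSpinorNorm.one.mul_sq c, ?_⟩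
  rw [one_mul, sq, Units.val_mul, map_mul, hc, ← WithZero.exp_add, Units.val_mul,
    FractionalIdeal.count_mul F 𝔭 I.ne_zero I.ne_zero, neg_add]

omit [Module R V] [IsScalarTower R F V] in
theorem hasSpinorIdeal_localize {τ : V ≃ₗ[F] V} {x : Fˣ} (h : IsSpinorNorm f τ x) :
    HasSpinorIdeal (R := R) f (fun 𝔭 => localize 𝔭 τ) (toPrincipalIdeal R F x) := by
  intro 𝔭
  refine ⟨_, isSpinorNorm_localize 𝔭 h, ?_⟩
  rw [← valuation_eq_exp_neg_count, ← valued_algebraMap]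
  rfl

variable [FiniteDimensional F V] {L : Submodule R V}

theorem exists_hasSpinorIdeal
    (hi : ∀ a : Fˣ, a ∈ spinorNorms f (specialOrthogonal f)) (L : Submodule R V)
    (I : (FractionalIdeal R⁰ F)ˣ) :
    ∃ σ ∈ adelicSpecialOrthogonal f L, HasSpinorIdeal f σ I := by
  -- At a place dividing `I`, a global element with the required valuation is by (i) the spinor norm
  -- of a global rotation, which is localized. Taking the identity at the other places makes the
  -- family adelic.
  have key : ∀ 𝔭 : HeightOneSpectrum R,
      ∃ σ : LocalSpace F V 𝔭 ≃ₗ[𝔭.adicCompletion F] LocalSpace F V 𝔭,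
      σ ∈ specialOrthogonal (localForm f 𝔭) ∧
      (FractionalIdeal.count F 𝔭 I.1 = 0 → σ = 1) ∧
      ∃ a : (𝔭.adicCompletion F)ˣ, IsSpinorNorm (localForm f 𝔭) σ a ∧
      Valued.v (a : 𝔭.adicCompletion F) = WithZero.exp (-(FractionalIdeal.count F 𝔭 I.1)) := by
    intro 𝔭
    by_cases h0 : FractionalIdeal.count F 𝔭 I.1 = 0
    · exact ⟨1, one_mem _, fun _ => rfl, 1, IsSpinorNorm.one, by simp [h0]⟩
    · obtain ⟨x, hx⟩ := HeightOneSpectrum.valuation_surjective F 𝔭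
        (WithZero.exp (-(FractionalIdeal.count F 𝔭 I.1)))
      have hx0 : x ≠ 0 := by
        rintro rfl
        rw [map_zero] at hx
        exact WithZero.exp_ne_zero hx.symm
      obtain ⟨τ, hτ, hτx⟩ := hi (Units.mk0 x hx0)
      refine ⟨localize 𝔭 τ, localize_mem_specialOrthogonal 𝔭 hτ, fun h => absurd h h0, _,
        isSpinorNorm_localize 𝔭 hτx, ?_⟩
      rw [← hx, ← valued_algebraMap]
      rfl
  choose σ hσ hσ1 hσI using key
  refine ⟨σ, ⟨hσ, ?_⟩, hσI⟩
  have hfin := FractionalIdeal.finite_factors (K := F) I.1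
  refine Set.Finite.subset (Filter.eventually_cofinite.1 hfin) fun 𝔭 h𝔭 h0 => h𝔭 ?_
  rw [hσ1 𝔭 h0, mapLocal_one]

theorem exists_isTransform_of_mem (hL : Submodule.IsLattice F L)
    {σ : ∀ 𝔭 : HeightOneSpectrum R,
      LocalSpace F V 𝔭 ≃ₗ[𝔭.adicCompletion F] LocalSpace F V 𝔭}
    (hσ : σ ∈ adelicSpecialOrthogonal f L) {I : (FractionalIdeal R⁰ F)ˣ}
    (hI : HasSpinorIdeal f σ I) : ∃ K, IsTransform f L I K ∧
      ∀ 𝔭, localLattice K 𝔭 = mapLocal (σ 𝔭) (localLattice L 𝔭) := by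
  obtain ⟨K, hK, h⟩ := exists_isLattice_mapLocal hL σ hσ.2
  exact ⟨K, ⟨hK, σ, hσ, hI, h⟩, h⟩

theorem exists_isTransform_of_mem_genus (hf : f.Nondegenerate) {K : Submodule R V}
    (hK : K ∈ genus f L) : ∃ I, IsTransform f L I K := by
  classical
  obtain ⟨hKL, σ, hσ, h⟩ := hK
  choose a ha using fun 𝔭 => exists_isSpinorNorm_local 𝔭 hf (hσ.1 𝔭)
  -- Where `σ` fixes `L_𝔭` it is replaced by the identity, which has the same effect on `L_𝔭`. Only
  -- finitely many valuations can then be nonzero, and they define an ideal.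
  let σ' : ∀ 𝔭 : HeightOneSpectrum R,
      LocalSpace F V 𝔭 ≃ₗ[𝔭.adicCompletion F] LocalSpace F V 𝔭 := fun 𝔭 =>
    if mapLocal (σ 𝔭) (localLattice L 𝔭) = localLattice L 𝔭 then 1 else σ 𝔭
  have hσ' : ∀ 𝔭, mapLocal (σ' 𝔭) (localLattice L 𝔭) = mapLocal (σ 𝔭) (localLattice L 𝔭) := by
    intro 𝔭
    by_cases h1 : mapLocal (σ 𝔭) (localLattice L 𝔭) = localLattice L 𝔭
    · rw [h1]; simp only [σ', if_pos h1, mapLocal_one]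
    · simp only [σ', if_neg h1]
  let n : HeightOneSpectrum R →₀ ℤ := Finsupp.onFinset hσ.2.toFinset
    (fun 𝔭 => if mapLocal (σ 𝔭) (localLattice L 𝔭) = localLattice L 𝔭 then 0
      else -WithZero.log (Valued.v (a 𝔭 : 𝔭.adicCompletion F)))
    (fun 𝔭 h0 => by
      rw [Set.Finite.mem_toFinset]
      intro h1
      exact h0 (if_pos h1))
  let I₀ : FractionalIdeal R⁰ F := n.prod (fun 𝔭 k => (𝔭.asIdeal : FractionalIdeal R⁰ F) ^ k)
  have hI₀ : I₀ ≠ 0 := Finset.prod_ne_zero_iff.2 fun 𝔭 _ =>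
    zpow_ne_zero _ (FractionalIdeal.coeIdeal_ne_zero.mpr 𝔭.ne_bot)
  refine ⟨Units.mk0 I₀ hI₀, hKL, σ', ⟨fun 𝔭 => ?_, ?_⟩, fun 𝔭 => ?_, fun 𝔭 => by rw [h, hσ']⟩
  · by_cases h1 : mapLocal (σ 𝔭) (localLattice L 𝔭) = localLattice L 𝔭
    · simp only [σ', if_pos h1]; exact one_mem _
    · simp only [σ', if_neg h1]; exact hσ.1 𝔭
  · simp only [hσ']
    exact hσ.2
  · rw [Units.val_mk0, FractionalIdeal.count_finsuppProd F 𝔭 n]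
    by_cases h1 : mapLocal (σ 𝔭) (localLattice L 𝔭) = localLattice L 𝔭
    · simp only [σ', if_pos h1, n, Finsupp.onFinset_apply]
      exact ⟨1, IsSpinorNorm.one, by simp⟩
    · simp only [σ', if_neg h1, n, Finsupp.onFinset_apply, neg_neg]
      refine ⟨a 𝔭, ha 𝔭, (WithZero.exp_log ?_).symm⟩
      exact (Valuation.ne_zero_iff Valued.v).2 (a 𝔭).ne_zero

theorem IsTransform.mem_genus {I : (FractionalIdeal R⁰ F)ˣ} {K : Submodule R V}
    (h : IsTransform f L I K) : K ∈ genus f L := by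
  obtain ⟨hK, σ, hσ, -, h⟩ := h
  exact ⟨hK, σ, hσ, h⟩

/-- The proper class of a transform of `L` depends only on the spinor ideal. -/
theorem IsTransform.properClass_eq (hSA : SpinStrongApproximation R f)
    (hL : Submodule.IsLattice F L)
    (hii : ∀ (𝔭 : HeightOneSpectrum R) (u : (𝔭.adicCompletionIntegers F)ˣ),
      Units.map (algebraMap (𝔭.adicCompletionIntegers F) (𝔭.adicCompletion F)).toMonoidHom u ∈
        spinorNorms (localForm f 𝔭) (localStabilizer f L 𝔭))
    {I : (FractionalIdeal R⁰ F)ˣ} {K K' : Submodule R V} (h : IsTransform f L I K)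
    (h' : IsTransform f L I K') : properClass f K' = properClass f K := by
  obtain ⟨hK, σ, hσ, hσI, hσK⟩ := h
  obtain ⟨hK', τ, hτ, hτI, hτK⟩ := h'
  choose a ha hav using hσI
  choose b hb hbv using hτI
  -- The spinor norms `a` and `b` have equal valuations, so `b⁻¹a` is a local unit and (ii) realizes
  -- it by a stabilizer of `L_𝔭`.
  have hω : ∀ 𝔭, ∃ ω ∈ localStabilizer f L 𝔭,
      IsSpinorNorm (localForm f 𝔭) ω ((b 𝔭)⁻¹ * a 𝔭) := by
    intro 𝔭
    have hu : Valued.v (((b 𝔭)⁻¹ * a 𝔭 : (𝔭.adicCompletion F)ˣ) : 𝔭.adicCompletion F) = 1 := by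
      rw [Units.val_mul, Units.val_inv_eq_inv_val, map_mul, map_inv₀, hav, hbv,
        inv_mul_cancel₀ WithZero.exp_ne_zero]
    obtain ⟨u, hu'⟩ := HeightOneSpectrum.adicCompletionIntegers.isUnit_iff_valued_eq_one.2
      (show Valued.v (⟨_, hu.le⟩ : 𝔭.adicCompletionIntegers F).1 = 1 from hu)
    obtain ⟨ω, hωL, hωn⟩ := hii 𝔭 u
    refine ⟨ω, hωL, ?_⟩
    convert hωn
    exact Units.ext (congrArg Subtype.val hu'.symm)
  choose ω hωL hωn using hω
  have hωA : ω ∈ adelicSpecialOrthogonal f L := by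
    refine ⟨fun 𝔭 => (hωL 𝔭).1, ?_⟩
    convert Set.finite_empty
    ext 𝔭
    simpa using (hωL 𝔭).2
  have hρ : τ * ω * σ⁻¹ ∈ adelicSpecialOrthogonal f K :=
    adelicSpecialOrthogonal_subset hK hL (mul_mem_adelicSpecialOrthogonal
      (mul_mem_adelicSpecialOrthogonal hτ hωA) (inv_mem_adelicSpecialOrthogonal hσ))
  -- The spinor norm of `τωσ⁻¹` is `b · b⁻¹a · a⁻¹ = 1`, and locally `τωσ⁻¹K = τωL = τL = K'`.
  obtain ⟨γ, hγ, hγK⟩ := hSA.exists_mapGlobal hK hρ fun 𝔭 => by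
    have h := ((hb 𝔭).mul (hωn 𝔭)).mul (ha 𝔭).inv
    rwa [mul_inv_cancel_left, mul_inv_cancel] at h
  refine properClass_eq_of_mem ⟨γ, hγ, ?_⟩
  refine eq_of_localLattice_eq hK' (isLattice_mapGlobal γ hK) fun 𝔭 => ?_
  rw [hγK, hτK, Pi.mul_apply, Pi.mul_apply, Pi.inv_apply, mapLocal_mul, mapLocal_mul,
    mapLocal_inv_eq (hσK 𝔭).symm, (hωL 𝔭).2]

/-- The genus of `L` is parametrized by fractional ideals, compatibly with multiplication. -/
theorem IsTransform.exists_mul (hf : f.Nondegenerate)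
    (hi : ∀ a : Fˣ, a ∈ spinorNorms f (specialOrthogonal f)) (hL : Submodule.IsLattice F L)
    {I J : (FractionalIdeal R⁰ F)ˣ} {K K' : Submodule R V} (h : IsTransform f L I K)
    (h' : IsTransform f L J K') (hKK' : properClass f K = properClass f K')
    (A : (FractionalIdeal R⁰ F)ˣ) :
    ∃ N N', IsTransform f L (A * I) N ∧ IsTransform f L (A * J) N' ∧
      properClass f N = properClass f N' := by
  obtain ⟨α, hα, hαA⟩ := exists_hasSpinorIdeal hi L A
  obtain ⟨-, σ, hσ, hσI, hσK⟩ := h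
  obtain ⟨-, ρ, hρ, hρJ, hρK⟩ := h'
  obtain ⟨τ, hτ, hτK⟩ : K ∈ properClass f K' := hKK' ▸ mem_properClass_self K
  let t : ∀ 𝔭 : HeightOneSpectrum R, LocalSpace F V 𝔭 ≃ₗ[𝔭.adicCompletion F] LocalSpace F V 𝔭 :=
    fun 𝔭 => localize 𝔭 τ
  have ht : t ∈ adelicSpecialOrthogonal f L := localize_mem_adelicSpecialOrthogonal hL hτ
  obtain ⟨N, hN, hNloc⟩ := exists_isTransform_of_mem hL (mul_mem_adelicSpecialOrthogonal hα hσ)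
    (hαA.mul hσI)
  -- Since `σL = tρL` locally, `ασL = t(t⁻¹αtρ)L`. The conjugate `t⁻¹αt` has the same spinor norms
  -- as `α`, so the lattices obtained from `ασ` and `t⁻¹αtρ` have ideals `A * I` and `A * J` and
  -- differ by the global rotation `τ`.
  have hconj : HasSpinorIdeal f (t⁻¹ * α * t) A := by
    intro 𝔭
    obtain ⟨a, ha, hav⟩ := hαA 𝔭
    obtain ⟨c, hc⟩ := exists_isSpinorNorm_local 𝔭 hf (ht.1 𝔭)
    refine ⟨a, ?_, hav⟩
    have h := (hc.inv.mul ha).mul hc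
    rwa [mul_comm c⁻¹, inv_mul_cancel_right] at h
  obtain ⟨N', hN', hNloc'⟩ := exists_isTransform_of_mem hL
    (mul_mem_adelicSpecialOrthogonal (mul_mem_adelicSpecialOrthogonal
      (mul_mem_adelicSpecialOrthogonal (inv_mem_adelicSpecialOrthogonal ht) hα) ht) hρ)
    (hconj.mul hρJ)
  refine ⟨N, N', hN, hN', properClass_eq_of_mem ⟨τ, hτ, ?_⟩⟩
  refine eq_of_localLattice_eq hN.1 (isLattice_mapGlobal τ hN'.1) fun 𝔭 => ?_
  have h1 : mapLocal (σ 𝔭) (localLattice L 𝔭) = mapLocal (t 𝔭 * ρ 𝔭) (localLattice L 𝔭) := by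
    rw [← hσK, hτK, localLattice_mapGlobal, hρK, mapLocal_mul]
  rw [hNloc, localLattice_mapGlobal, hNloc', ← mapLocal_mul]
  have h2 : localize 𝔭 τ * (t⁻¹ * α * t * ρ) 𝔭 = α 𝔭 * (t 𝔭 * ρ 𝔭) := by
    change t 𝔭 * ((t 𝔭)⁻¹ * α 𝔭 * t 𝔭 * ρ 𝔭) = _
    group
  rw [h2, Pi.mul_apply, mapLocal_mul, h1, ← mapLocal_mul]

theorem isTransform_self (hL : Submodule.IsLattice F L) {I : (FractionalIdeal R⁰ F)ˣ}
    (hI : HasSpinorIdeal f 1 I) : IsTransform f L I L :=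
  ⟨hL, 1, one_mem_adelicSpecialOrthogonal L, hI, fun _ => (mapLocal_one _).symm⟩

end ClassesAndIdeals

end SpinLattice

/-! ### The class number. -/

theorem corollary3p3
    {R : Type*} [CommRing R] [IsDedekindDomain R]
    {F : Type*} [Field F] [Algebra R F] [IsFractionRing R F] [Invertible (2 : F)]
    {V : Type*} [AddCommGroup V] [Module F V] [FiniteDimensional F V]
    [Module R V] [IsScalarTower R F V]
    (f : QuadraticForm F V) (hf : f.Nondegenerate) (hdim : 3 ≤ Module.finrank F V)
    (L : Submodule R V) (hL : Submodule.IsLattice F L)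
    (hint : ∀ x ∈ L, ∃ r : R, f x = algebraMap R F r)
    (hSA : SpinLattice.SpinStrongApproximation R f)
    (hi : ∀ a : Fˣ, a ∈ SpinLattice.spinorNorms f (SpinLattice.specialOrthogonal f))
    (hii : ∀ (𝔭 : HeightOneSpectrum R) (u : (𝔭.adicCompletionIntegers F)ˣ),
      Units.map (algebraMap (𝔭.adicCompletionIntegers F) (𝔭.adicCompletion F)).toMonoidHom u ∈
        SpinLattice.spinorNorms (SpinLattice.localForm f 𝔭)
          (SpinLattice.localStabilizer f L 𝔭)) :
    (Finite (SpinLattice.PicModTwo R) →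
      ∃ h : ℕ, SpinLattice.properClassNumber f L = h ∧
        h ∣ Nat.card (SpinLattice.PicModTwo R)) ∧
    (IsPrincipalIdealRing R → SpinLattice.properClassNumber f L = 1) := by
  classical
  choose σ hσ hσI using SpinLattice.exists_hasSpinorIdeal (f := f) hi L
  choose T hT hTloc using fun I => SpinLattice.exists_isTransform_of_mem hL (hσ I) (hσI I)
  let Φ : (FractionalIdeal (nonZeroDivisors R) F)ˣ → Set (Submodule R V) :=
    fun I => SpinLattice.properClass f (T I)
  -- `Φ` does not depend on the chosen transforms: any lattice obtained from `L` with spinor ideal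
  -- `I` has class `Φ I`.
  have hΦ : ∀ {I K}, SpinLattice.IsTransform f L I K → SpinLattice.properClass f K = Φ I :=
    fun h => (hT _).properClass_eq hSA hL hii h
  have hone : Φ 1 = SpinLattice.properClass f L := by
    have h := SpinLattice.hasSpinorIdeal_one_mul_self (f := f)
      (1 : (FractionalIdeal (nonZeroDivisors R) F)ˣ)
    rw [mul_one] at h
    exact (hΦ (SpinLattice.isTransform_self hL h)).symm
  have hmul : ∀ A I J, Φ I = Φ J → Φ (A * I) = Φ (A * J) := by
    intro A I J hIJ
    obtain ⟨N, N', hN, hN', h⟩ := (hT I).exists_mul hf hi hL (hT J) hIJ A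
    rw [← hΦ hN, ← hΦ hN', h]
  have hprin : ∀ x : Fˣ, Φ (toPrincipalIdeal R F x) = Φ 1 := by
    intro x
    obtain ⟨τ, hτ, hτx⟩ := hi x
    rw [hone, ← hΦ (K := SpinLattice.mapGlobal τ L)
      ⟨SpinLattice.isLattice_mapGlobal τ hL, _,
        SpinLattice.localize_mem_adelicSpecialOrthogonal hL hτ,
        SpinLattice.hasSpinorIdeal_localize hτx, SpinLattice.localLattice_mapGlobal τ L⟩]
    exact SpinLattice.properClass_eq_of_mem ⟨τ, hτ, rfl⟩
  have hsq : ∀ I, Φ (I * I) = Φ 1 := fun I => by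
    rw [hone, ← hΦ (SpinLattice.isTransform_self hL (SpinLattice.hasSpinorIdeal_one_mul_self I))]
  have hrange : SpinLattice.properClass f '' SpinLattice.genus f L = Set.range Φ := by
    ext C
    constructor
    · rintro ⟨K, hK, rfl⟩
      obtain ⟨I, hI⟩ := SpinLattice.exists_isTransform_of_mem_genus hf hK
      exact ⟨I, (hΦ hI).symm⟩
    · rintro ⟨I, rfl⟩
      exact ⟨T I, (hT I).mem_genus, rfl⟩
  have hfin : Finite (SpinLattice.PicModTwo R) →
      ∃ h : ℕ, SpinLattice.properClassNumber f L = h ∧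
        h ∣ Nat.card (SpinLattice.PicModTwo R) := fun _ => by
    rw [SpinLattice.properClassNumber, hrange]
    exact SpinLattice.exists_encard_range_dvd Φ hmul hprin hsq
  refine ⟨hfin, fun _ => ?_⟩
  -- Over a principal ideal domain the class group is trivial, so `Pic(R)/2` has one element and the
  -- class number divides `1`.
  have : Subsingleton (CommRing.Pic R) := (ClassGroup.equivPic R).toEquiv.symm.subsingleton
  have : Subsingleton (Additive (CommRing.Pic R)) := this
  have hsub : Subsingleton (SpinLattice.PicModTwo R) := inferInstance
  obtain ⟨h, hh, hdvd⟩ := hfin inferInstance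
  rw [Nat.card_unique, Nat.dvd_one] at hdvd
  rw [hh, hdvd, Nat.cast_one]
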